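/- **Theorem 3.** A composition of $n\ge 0$ is a finite sequence $c=a_1a_2\dots a_k$ of positive integers with sum $n$. A word $b_1b_2b_3$ of positive integers *occurs* in $c$ at position $i$ ($1\le i\le k-2$) if $b_1\le a_i$, $b_2\le a_{i+1}$ and $b_3\le a_{i+2}$; $c$ *contains* the word if it occurs at some position, and the number of occurrences is the number of such positions. Then: 1. Let $a(n)$ be the number of compositions of $n$ that contain neither $234$ nor $432$. As formal power series, $$\sum_{n\ge0}a(n)x^n=-\frac{x^{16}+x^{15}+x^{12}+2x^{10}-x^7+x^5-x^4-x^2+2x-1}{x^{17}+x^{16}+x^{13}+2x^{11}-x^{10}+x^9-x^8+x^7-2x^5+x^4+2x^2-3x+1}.$$ 2. $a(n)\sim C\alpha^n$ as $n\to\infty$, with constants $C=0.548269839581\dots$ and $\alpha=1.976902834153\dots$. 3. Let $A(n;c,d)$ be the number of compositions of $n$ with exactly $c$ occurrences of $234$ and exactly $d$ occurrences of $432$. As formal power series, $$\sum_{n\ge0}\sum_{c\ge0}\sum_{d\ge0}A(n;c,d)\,x^nX^cY^d=\frac{\mathrm{Numer}(x,X,Y)}{\mathrm{Denom}(x,X,Y)},$$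 where $$\begin{aligned}\mathrm{Numer}(x,X,Y)=\ &-1+x^{12}-2x^{11}+x^{3}+2x^{5}-x^{6}-x^{4}-x^{7}-3x^{2}+x^{8}+2x^{10}-x^{17}+x^{15}X^{2}-x^{13}X^{2}\\ &\quad -x^{12}X-x^{12}Y-x^{13}Y^{2}+x^{15}Y^{2}-x^{17}Y^{2}-x^{17}X^{2}-2x^{15}X-2x^{15}Y+2x^{11}Y\\ &\quad -2x^{10}X+2x^{13}Y+2x^{11}X-2x^{10}Y+2x^{13}X+2x^{17}Y+2x^{17}X+x^{15}+3x+x^{7}XY-x^{13}+x^{6}XY\\ &\quad -x^{8}XY+x^{4}XY+x^{15}X^{2}Y^{2}-x^{17}X^{2}Y^{2}+x^{13}XY^{2}+x^{13}X^{2}Y+x^{12}XY-3x^{13}XY\\ &\quad -2x^{11}XY+2x^{10}XY-2x^{15}X^{2}Y-2x^{15}XY^{2}+4x^{15}XY+2x^{17}X^{2}Y-2x^{5}XY-4x^{17}XY\\ &\quad +2x^{17}XY^{2}\end{aligned}$$ and $$\begin{aligned}\mathrm{Denom}(x,X,Y)=\ &-1+2x^{12}-3x^{11}+2x^{3}+3x^{5}-2x^{6}-x^{4}-x^{7}-5x^{2}+2x^{8}+2x^{10}+2x^{16}Y+2x^{16}X\\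 &\quad -2x^{18}Y-2x^{14}X-2x^{14}Y-2x^{18}X-2x^{12}X-2x^{12}Y+x^{14}X^{2}+x^{9}X+x^{14}Y^{2}+x^{18}Y^{2}\\ &\quad -x^{16}Y^{2}+x^{18}X^{2}+x^{9}Y-x^{16}X^{2}+3x^{11}Y-2x^{10}X+x^{13}Y+3x^{11}X-2x^{10}Y+x^{13}X\\ &\quad +4x+2x^{16}XY^{2}+x^{7}XY+4x^{18}XY-4x^{16}XY-x^{13}-2x^{18}XY^{2}+2x^{6}XY-2x^{18}X^{2}Y-2x^{8}XY\\ &\quad +2x^{16}X^{2}Y+3x^{14}XY+x^{4}XY+2x^{12}XY-2x^{9}+x^{14}-x^{13}XY-3x^{11}XY+2x^{10}XY-x^{14}X^{2}Y\\ &\quad -x^{14}XY^{2}-x^{16}X^{2}Y^{2}+x^{18}X^{2}Y^{2}-3x^{5}XY+x^{18}-x^{16}.\end{aligned}$$ 4. On the compositions of $n$ with the uniform distribution, let $N_{234}$ and $N_{432}$ be the numbers of occurrences of $234$ and of $432$. Each of these two random variables has expectation $\frac{n-9}{128}+O(n2^{-n})$, hence asymptotically equivalent to $\frac{n}{128}$,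 and variance $\frac{147}{16384}n-\frac{1439}{16384}+O(n2^{-n})$ as $n\to\infty$. 5. The correlation coefficient of $N_{234}$ and $N_{432}$ tends to $\frac{71}{147}=0.482993197\dots$ as $n\to\infty$. The pair is asymptotically jointly normal with that correlation as far as the mixed moments up to order six: for all integers $i,j\ge0$ with $i+j\le6$, $$\mathbb E\left[\left(\frac{N_{234}-\mathbb E N_{234}}{\sqrt{\operatorname{Var}N_{234}}}\right)^{i}\left(\frac{N_{432}-\mathbb E N_{432}}{\sqrt{\operatorname{Var}N_{432}}}\right)^{j}\right]\longrightarrow\mathbb E\left[Z_1^{\,i}Z_2^{\,j}\right],$$ where $(Z_1,Z_2)$ is bivariate normal with means $0$, variances $1$ and correlation $\frac{71}{147}$. -/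

import Mathlib

open Filter Topology Asymptotics MeasureTheory ProbabilityTheory

namespace CompositionPattern

/-- The word `b = b₁ … b_s` occurs in the word `a = a₁ … a_k` at the (zero-based) position `i`:
the window of `a` of length `s` which starts there lies inside `a` and dominates `b` entrywise. -/
def OccursAt (a b : List ℕ) (i : ℕ) : Prop :=
  i + b.length ≤ a.length ∧ ∀ j < b.length, b.getD j 0 ≤ a.getD (i + j) 0

instance (a b : List ℕ) : DecidablePred (OccursAt a b) := fun i => by
  unfold OccursAt; infer_instance

/-- The composition `c` includes the word `b`. -/
def Includes {n : ℕ} (c : Composition n) (b : List ℕ) : Prop :=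
  ∃ i, OccursAt c.blocks b i

/-- The composition `c` avoids the word `b`. -/
def Avoids {n : ℕ} (c : Composition n) (b : List ℕ) : Prop :=
  ¬ Includes c b

/-- The number of occurrences of `b` in the composition `c`, i.e. of positions at which it occurs.
Positions beyond the length of `c` are irrelevant, since nothing occurs there. -/
def occurrences (b : List ℕ) {n : ℕ} (c : Composition n) : ℕ :=
  ((Finset.range (c.length + 1)).filter (OccursAt c.blocks b)).card

/-- `a(n)`: the number of compositions of `n` that contain neither `234` nor `432`. -/
noncomputable def avoidCount (n : ℕ) : ℕ :=
  Nat.card {c : Composition n // Avoids c [2, 3, 4] ∧ Avoids c [4, 3, 2]}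

/-- `A(n; k, l)`: the number of compositions of `n` with exactly `k` occurrences of `234` and
exactly `l` occurrences of `432`. -/
noncomputable def occCount (n k l : ℕ) : ℕ :=
  Nat.card {c : Composition n // occurrences [2, 3, 4] c = k ∧ occurrences [4, 3, 2] c = l}

section Polynomials

variable {R : Type*} [CommRing R]

/-- Numerator of the generating function of `a(n)` (up to a global sign). -/
def avoidNumer (x : R) : R :=
  x ^ 16 + x ^ 15 + x ^ 12 + 2 * x ^ 10 - x ^ 7 + x ^ 5 - x ^ 4 - x ^ 2 + 2 * x - 1

/-- Denominator of the generating function of `a(n)`. -/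
def avoidDenom (x : R) : R :=
  x ^ 17 + x ^ 16 + x ^ 13 + 2 * x ^ 11 - x ^ 10 + x ^ 9 - x ^ 8 + x ^ 7 - 2 * x ^ 5 + x ^ 4
    + 2 * x ^ 2 - 3 * x + 1

/-- Numerator of the trivariate generating function. -/
def numer (x X Y : R) : R :=
  -1 + x ^ 12 - 2 * x ^ 11 + x ^ 3 + 2 * x ^ 5 - x ^ 6 - x ^ 4 - x ^ 7 - 3 * x ^ 2 + x ^ 8
    + 2 * x ^ 10 - x ^ 17 + x ^ 15 * X ^ 2 - x ^ 13 * X ^ 2 - x ^ 12 * X - x ^ 12 * Y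
    - x ^ 13 * Y ^ 2 + x ^ 15 * Y ^ 2 - x ^ 17 * Y ^ 2 - x ^ 17 * X ^ 2 - 2 * x ^ 15 * X
    - 2 * x ^ 15 * Y + 2 * x ^ 11 * Y - 2 * x ^ 10 * X + 2 * x ^ 13 * Y + 2 * x ^ 11 * X
    - 2 * x ^ 10 * Y + 2 * x ^ 13 * X + 2 * x ^ 17 * Y + 2 * x ^ 17 * X + x ^ 15 + 3 * x
    + x ^ 7 * X * Y - x ^ 13 + x ^ 6 * X * Y - x ^ 8 * X * Y + x ^ 4 * X * Y
    + x ^ 15 * X ^ 2 * Y ^ 2 - x ^ 17 * X ^ 2 * Y ^ 2 + x ^ 13 * X * Y ^ 2 + x ^ 13 * X ^ 2 * Y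
    + x ^ 12 * X * Y - 3 * x ^ 13 * X * Y - 2 * x ^ 11 * X * Y + 2 * x ^ 10 * X * Y
    - 2 * x ^ 15 * X ^ 2 * Y - 2 * x ^ 15 * X * Y ^ 2 + 4 * x ^ 15 * X * Y
    + 2 * x ^ 17 * X ^ 2 * Y - 2 * x ^ 5 * X * Y - 4 * x ^ 17 * X * Y + 2 * x ^ 17 * X * Y ^ 2

/-- Denominator of the trivariate generating function. -/
def denom (x X Y : R) : R :=
  -1 + 2 * x ^ 12 - 3 * x ^ 11 + 2 * x ^ 3 + 3 * x ^ 5 - 2 * x ^ 6 - x ^ 4 - x ^ 7 - 5 * x ^ 2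
    + 2 * x ^ 8 + 2 * x ^ 10 + 2 * x ^ 16 * Y + 2 * x ^ 16 * X - 2 * x ^ 18 * Y - 2 * x ^ 14 * X
    - 2 * x ^ 14 * Y - 2 * x ^ 18 * X - 2 * x ^ 12 * X - 2 * x ^ 12 * Y + x ^ 14 * X ^ 2
    + x ^ 9 * X + x ^ 14 * Y ^ 2 + x ^ 18 * Y ^ 2 - x ^ 16 * Y ^ 2 + x ^ 18 * X ^ 2 + x ^ 9 * Y
    - x ^ 16 * X ^ 2 + 3 * x ^ 11 * Y - 2 * x ^ 10 * X + x ^ 13 * Y + 3 * x ^ 11 * X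
    - 2 * x ^ 10 * Y + x ^ 13 * X + 4 * x + 2 * x ^ 16 * X * Y ^ 2 + x ^ 7 * X * Y
    + 4 * x ^ 18 * X * Y - 4 * x ^ 16 * X * Y - x ^ 13 - 2 * x ^ 18 * X * Y ^ 2
    + 2 * x ^ 6 * X * Y - 2 * x ^ 18 * X ^ 2 * Y - 2 * x ^ 8 * X * Y + 2 * x ^ 16 * X ^ 2 * Y
    + 3 * x ^ 14 * X * Y + x ^ 4 * X * Y + 2 * x ^ 12 * X * Y - 2 * x ^ 9 + x ^ 14
    - x ^ 13 * X * Y - 3 * x ^ 11 * X * Y + 2 * x ^ 10 * X * Y - x ^ 14 * X ^ 2 * Y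
    - x ^ 14 * X * Y ^ 2 - x ^ 16 * X ^ 2 * Y ^ 2 + x ^ 18 * X ^ 2 * Y ^ 2 - 3 * x ^ 5 * X * Y
    + x ^ 18 - x ^ 16

end Polynomials

/-- The univariate generating function `∑ a(n) xⁿ`. -/
noncomputable def avoidSeries : PowerSeries ℤ :=
  PowerSeries.mk fun n => (avoidCount n : ℤ)

/-- The trivariate generating function `∑ A(n; k, l) xⁿ Xᵏ Yˡ`; the variables with indices
`0`, `1`, `2` are `x`, `X`, `Y`. -/
noncomputable def occSeries : MvPowerSeries (Fin 3) ℤ :=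
  fun m => (occCount (m 0) (m 1) (m 2) : ℤ)

/-- Expectation of `f` on a uniformly random composition of `n`. -/
noncomputable def mean (n : ℕ) (f : Composition n → ℝ) : ℝ :=
  (∑ c, f c) / Fintype.card (Composition n)

/-- Covariance of `f` and `g` on a uniformly random composition of `n`. -/
noncomputable def cov (n : ℕ) (f g : Composition n → ℝ) : ℝ :=
  mean n fun c => (f c - mean n f) * (g c - mean n g)

/-- Variance of `f` on a uniformly random composition of `n`. -/
noncomputable def var (n : ℕ) (f : Composition n → ℝ) : ℝ :=
  mean n fun c => (f c - mean n f) ^ 2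

/-- Correlation coefficient of `f` and `g` on a uniformly random composition of `n`. -/
noncomputable def corr (n : ℕ) (f g : Composition n → ℝ) : ℝ :=
  cov n f g / (√(var n f) * √(var n g))

/-- The standardization of `f`: centred at the expectation, divided by the standard deviation. -/
noncomputable def standardize (n : ℕ) (f : Composition n → ℝ) (c : Composition n) : ℝ :=
  (f c - mean n f) / √(var n f)

/-- The random variable `number of occurrences of b` on the compositions of `n`. -/
def occ (b : List ℕ) (n : ℕ) (c : Composition n) : ℝ :=
  occurrences b c

/-- The bivariate normal law with standard normal marginals and correlation `ρ`. -/
noncomputable def bivariateNormal (ρ : ℝ) : Measure (EuclideanSpace ℝ (Fin 2)) :=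
  multivariateGaussian 0 !![1, ρ; ρ, 1]

end CompositionPattern

namespace CompositionPattern

/-! ### Occurrences in lists -/

/-! A composition is read letter by letter, remembering the two preceding letters and weighting by X
to the number of 234 times Y to the number of 432. Only letters truncated at 4 matter, and the pairs
of preceding letters fall into seven classes with equal series, so the series `extSeries` satisfy a
7×7 linear system. Its elimination gives `weightSeries_mul_denom`, valid for weights in any
commutative ring. Everything else is a choice of that ring and of the weights.

Weights 0, 0 select the avoiding compositions, and formal variables give the trivariate series. The
asymptotics of `avoidCount` come from a simple pole at z ≈ 0.5058: the denominator is (1 - x/z)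
U(x), and U is so close to 1 in the coefficient norm of radius 0.55 that 1/U has coefficients
O(0.55^(-n)) (`exists_quotient`, `isEquivalent_coeff_of_pole`). No complex analysis enters.

Weights (1+t)^a, (1+t)^b turn the coefficient of t^k into a binomial moment. The orders 1 and 2 are
rational in x with poles at 1/2 and 1 only; partial fractions give closed forms for mean and
variance, and the variance of the sum of the two statistics gives the covariance.

For normality the weights are exp(at), exp(bt). At t = 0 the denominator is -(1-2x)(1-x)^2; its
simple root 1/2 lifts by Hensel's lemma to a root in ℝ[[t]], so the n-th coefficient is c l^n with
l(0) = 2, up to an error whose coefficient at each power of t grows polynomially in n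
(`exists_dominant_pole`). After division by the number of compositions this is a quasi-power, and
centring and rescaling by √n give exp(σt²) coefficientwise (`coeffTendsto_of_quasiPower`). The known
variances and covariance determine σ. This settles the moments of N_234 + b N_432 for every real b;
they are polynomials in b, whose coefficients are the mixed moments, recovered by a Vandermonde
inversion. -/

/-- The number of occurrences of `b` in the list `l`. -/
def occCountIn (b l : List ℕ) : ℕ :=
  ((Finset.range (l.length + 1)).filter (OccursAt l b)).card

lemma occurrences_eq (b : List ℕ) {n : ℕ} (c : Composition n) :
    occurrences b c = occCountIn b c.blocks := rfl

lemma occursAt_cons_succ (b l : List ℕ) (a i : ℕ) :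
    OccursAt (a :: l) b (i + 1) ↔ OccursAt l b i := by
  unfold OccursAt
  refine and_congr (by simp; omega) (forall₂_congr fun j _ => ?_)
  rw [show i + 1 + j = (i + j) + 1 by ring, List.getD_cons_succ]

lemma occCountIn_cons (b l : List ℕ) (a : ℕ) :
    occCountIn b (a :: l) = (if OccursAt (a :: l) b 0 then 1 else 0) + occCountIn b l := by
  unfold occCountIn
  rw [Finset.card_filter, Finset.card_filter, List.length_cons, Finset.sum_range_succ', add_comm]
  simp only [occursAt_cons_succ]

lemma occursAt_three_zero (b₁ b₂ b₃ : ℕ) (p q r : ℕ) (l : List ℕ) :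
    OccursAt (p :: q :: r :: l) [b₁, b₂, b₃] 0 ↔ b₁ ≤ p ∧ b₂ ≤ q ∧ b₃ ≤ r := by
  simp only [OccursAt, List.length_cons, List.length_nil, Nat.forall_lt_succ_right, zero_add]
  simp [and_assoc]

lemma not_occursAt_of_length_lt {b l : List ℕ} (h : l.length < b.length) (i : ℕ) :
    ¬ OccursAt l b i := fun H => by have := H.1; omega

lemma occCountIn_of_length_lt {b l : List ℕ} (h : l.length < b.length) : occCountIn b l = 0 := by
  simp [occCountIn, not_occursAt_of_length_lt h]

lemma occCountIn_eq_zero_iff {b l : List ℕ} (hb : b ≠ []) :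
    occCountIn b l = 0 ↔ ¬ ∃ i, OccursAt l b i := by
  have := List.length_pos_iff.2 hb
  simp only [occCountIn, Finset.card_eq_zero, Finset.filter_eq_empty_iff, Finset.mem_range,
    not_exists]
  exact ⟨fun h i H => h (by have := H.1; omega) H, fun h i _ => h i⟩

/-- Truncating the letters at a bound of the pattern does not change its occurrences. -/
lemma occCountIn_map_min {b : List ℕ} {m : ℕ} (hb : ∀ x ∈ b, x ≤ m) (l : List ℕ) :
    occCountIn b (l.map (min m)) = occCountIn b l := by
  unfold occCountIn
  rw [List.length_map]
  congr 1
  refine Finset.filter_congr fun i _ => ?_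
  unfold OccursAt
  rw [List.length_map]
  refine and_congr_right fun hi => forall₂_congr fun j hj => ?_
  have h1 : i + j < l.length := by omega
  have h2 := hb _ (List.getElem_mem hj)
  rw [List.getD_eq_getElem _ _ hj, List.getD_eq_getElem _ _ h1,
    List.getD_eq_getElem _ _ (by simpa using h1), List.getElem_map]
  omega

/-! ### Compositions as lists -/

/-- The block lists of the compositions of `n`. -/
def blockLists (n : ℕ) : Finset (List ℕ) :=
  (Finset.univ : Finset (Composition n)).image Composition.blocks

lemma mem_blockLists {n : ℕ} {l : List ℕ} :
    l ∈ blockLists n ↔ (∀ i ∈ l, 0 < i) ∧ l.sum = n := by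
  simp only [blockLists, Finset.mem_image, Finset.mem_univ, true_and]
  constructor
  · rintro ⟨c, rfl⟩
    exact ⟨fun i hi => c.blocks_pos hi, c.blocks_sum⟩
  · rintro ⟨h1, h2⟩
    exact ⟨⟨l, fun {i} hi => h1 i hi, h2⟩, rfl⟩

lemma sum_blockLists {M : Type*} [AddCommMonoid M] (n : ℕ) (f : List ℕ → M) :
    ∑ l ∈ blockLists n, f l = ∑ c : Composition n, f c.blocks :=
  Finset.sum_image fun _ _ _ _ h => Composition.ext h

lemma blockLists_zero : blockLists 0 = {[]} := by
  ext l
  rw [mem_blockLists, Finset.mem_singleton]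
  constructor
  · rintro ⟨h1, h2⟩
    cases l with
    | nil => rfl
    | cons a l =>
      have := h1 a (by simp)
      simp at h2
      omega
  · rintro rfl
    simp

lemma blockLists_succ (n : ℕ) :
    blockLists (n + 1) =
      (Finset.range (n + 1)).biUnion fun a => (blockLists (n - a)).image (List.cons (a + 1)) := by
  ext l
  simp only [mem_blockLists, Finset.mem_biUnion, Finset.mem_range, Finset.mem_image]
  constructor
  · rintro ⟨h1, h2⟩
    cases l with
    | nil => simp at h2
    | cons a l =>
      have ha := h1 a (by simp)
      simp only [List.sum_cons] at h2
      exact ⟨a - 1, by omega, l, ⟨fun i hi => h1 i (by simp [hi]), by omega⟩, by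
        congr 1; omega⟩
  · rintro ⟨a, ha, l, ⟨h1, h2⟩, rfl⟩
    refine ⟨fun i hi => ?_, by simp only [List.sum_cons]; omega⟩
    rcases List.mem_cons.1 hi with rfl | hi
    · omega
    · exact h1 i hi

lemma sum_blockLists_succ {M : Type*} [AddCommMonoid M] (n : ℕ) (f : List ℕ → M) :
    ∑ l ∈ blockLists (n + 1), f l =
      ∑ a ∈ Finset.range (n + 1), ∑ l ∈ blockLists (n - a), f ((a + 1) :: l) := by
  rw [blockLists_succ, Finset.sum_biUnion]
  · refine Finset.sum_congr rfl fun a _ => Finset.sum_image fun l _ l' _ h => ?_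
    exact (List.cons.inj h).2
  · intro a _ a' _ hne
    rw [Function.onFun, Finset.disjoint_left]
    intro l h1 h2
    simp only [Finset.mem_image] at h1 h2
    obtain ⟨l1, _, rfl⟩ := h1
    obtain ⟨l2, _, h⟩ := h2
    have := (List.cons.inj h).1
    omega

/-! ### The transfer system -/

section Transfer

variable {R : Type*} [CommRing R]

/-- The weight `X ^ (occurrences of 234) * Y ^ (occurrences of 432)` of a list. -/
def weight (X Y : R) (l : List ℕ) : R :=
  X ^ occCountIn [2, 3, 4] l * Y ^ occCountIn [4, 3, 2] l

/-- The generating function of the weights of the compositions which are preceded by the two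
letters `p` and `q`. -/
noncomputable def extSeries (X Y : R) (p q : ℕ) : PowerSeries R :=
  PowerSeries.mk fun n => ∑ l ∈ blockLists n, weight X Y (p :: q :: l)

/-- The weighted generating function of all compositions. -/
noncomputable def weightSeries (X Y : R) : PowerSeries R :=
  PowerSeries.mk fun n =>
    ∑ c : Composition n, X ^ occurrences [2, 3, 4] c * Y ^ occurrences [4, 3, 2] c

/-- The factor contributed by three consecutive letters. -/
def letterWeight (X Y : R) (p q r : ℕ) : R :=
  (if 2 ≤ p ∧ 3 ≤ q ∧ 4 ≤ r then X else 1) * (if 4 ≤ p ∧ 3 ≤ q ∧ 2 ≤ r then Y else 1)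

/-- Both patterns have length three, so only the window at position 0 sees the letter `p`. This
makes two letters of memory sufficient. -/
lemma weight_cons (X Y : R) (p q r : ℕ) (l : List ℕ) :
    weight X Y (p :: q :: r :: l) = letterWeight X Y p q r * weight X Y (q :: r :: l) := by
  unfold weight letterWeight
  rw [occCountIn_cons _ (q :: r :: l), occCountIn_cons _ (q :: r :: l)]
  simp only [occursAt_three_zero, pow_add]
  split_ifs <;> simp <;> ring

lemma weight_pair (X Y : R) (p q : ℕ) : weight X Y [p, q] = 1 := by
  simp [weight, occCountIn_of_length_lt]

lemma weight_map_min (X Y : R) (l : List ℕ) : weight X Y (l.map (min 4)) = weight X Y l := by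
  unfold weight
  rw [occCountIn_map_min (by simp), occCountIn_map_min (by simp)]

/-- No letter of either pattern exceeds 4, so the system has finitely many states. -/
lemma extSeries_min (X Y : R) (p q : ℕ) :
    extSeries X Y p q = extSeries X Y (min 4 p) (min 4 q) := by
  unfold extSeries
  congr 1
  funext n
  refine Finset.sum_congr rfl fun l _ => ?_
  rw [← weight_map_min X Y (p :: q :: l), ← weight_map_min X Y (min 4 p :: min 4 q :: l)]
  simp

/-- A leading 1 starts no occurrence, since both patterns begin with a letter at least 2. The prefix
1, 1 thus stands for an empty past. -/
lemma extSeries_one_one (X Y : R) : extSeries X Y 1 1 = weightSeries X Y := by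
  unfold extSeries weightSeries
  congr 1
  funext n
  refine Eq.trans ?_
    (sum_blockLists n fun l => X ^ occCountIn [2, 3, 4] l * Y ^ occCountIn [4, 3, 2] l)
  refine Finset.sum_congr rfl fun l _ => ?_
  have key : ∀ b₁ b₂ b₃ : ℕ, 2 ≤ b₁ → 2 ≤ b₂ →
      occCountIn [b₁, b₂, b₃] (1 :: 1 :: l) = occCountIn [b₁, b₂, b₃] l := by
    intro b₁ b₂ b₃ h1 h2
    have : ∀ l, ¬ OccursAt (1 :: l) [b₁, b₂, b₃] 0 := by
      intro l h
      have := h.2 0 (by simp)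
      simp at this
      omega
    rw [occCountIn_cons, occCountIn_cons]
    simp [this]
  rw [weight, key _ _ _ (by norm_num) (by norm_num), key _ _ _ (by norm_num) (by norm_num)]

lemma coeff_zero_extSeries (X Y : R) (p q : ℕ) :
    PowerSeries.coeff 0 (extSeries X Y p q) = 1 := by
  simp [extSeries, blockLists_zero, weight_pair]

lemma coeff_succ_extSeries (X Y : R) (p q n : ℕ) :
    PowerSeries.coeff (n + 1) (extSeries X Y p q) =
      ∑ a ∈ Finset.range (n + 1),
        letterWeight X Y p q (a + 1) * PowerSeries.coeff (n - a) (extSeries X Y q (a + 1)) := by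
  simp only [extSeries, PowerSeries.coeff_mk, sum_blockLists_succ, weight_cons, Finset.mul_sum]

open PowerSeries in
/-- A series whose coefficients are convolutions with an eventually constant family of series. -/
lemma eq_of_coeff_eq_sum {P : PowerSeries R} {u : ℕ → PowerSeries R} (h0 : coeff 0 P = 1)
    (hu : ∀ a, 4 ≤ a → u a = u 4)
    (h : ∀ n, coeff (n + 1) P = ∑ a ∈ Finset.range (n + 1), coeff (n - a) (u (a + 1))) :
    (1 - X) * (P - 1 - X * u 1 - X ^ 2 * u 2 - X ^ 3 * u 3) = X ^ 4 * u 4 := by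
  have key : P = 1 + X * u 1 + X ^ 2 * u 2 + X ^ 3 * u 3
      + X ^ 4 * (PowerSeries.mk (fun _ => (1 : R)) * u 4) := by
    ext n
    rcases n with _ | n
    · simp [h0]
    rw [h]
    rcases n with _ | _ | _ | n
    · simp [coeff_X_pow_mul', coeff_one, coeff_succ_X_mul]
    · simp [coeff_X_pow_mul', coeff_one, coeff_succ_X_mul, Finset.sum_range_succ]
    · simp [coeff_X_pow_mul', coeff_one, coeff_succ_X_mul, Finset.sum_range_succ]
    · rw [Finset.sum_range_succ', Finset.sum_range_succ', Finset.sum_range_succ']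
      have e : ∀ k ∈ Finset.range (n + 1), coeff (n + 1 + 1 + 1 - (k + 1 + 1 + 1))
          (u (k + 1 + 1 + 1 + 1)) = coeff (n - k) (u 4) := fun k _ => by
        rw [hu _ (by omega)]
        congr 2
        omega
      rw [Finset.sum_congr rfl e]
      have e2 : coeff (n + 4) (X ^ 4 * (PowerSeries.mk (fun _ => (1 : R)) * u 4)) =
          ∑ k ∈ Finset.range (n + 1), coeff (n - k) (u 4) := by
        rw [coeff_X_pow_mul, coeff_mul, Finset.Nat.sum_antidiagonal_eq_sum_range_succ_mk]
        simp
      have e1 : coeff (n + 1 + 1 + 1 + 1) (1 : PowerSeries R) = 0 := by simp [coeff_one]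
      simp only [map_add, e1, coeff_succ_X_mul]
      rw [e2, show n + 1 + 1 + 1 + 1 = (n + 2) + 2 by rfl, coeff_X_pow_mul,
        show n + 2 + 2 = (n + 1) + 3 by rfl, coeff_X_pow_mul]
      simp only [zero_add, Nat.sub_zero]
      rw [show n + 1 + 1 + 1 - (0 + 1 + 1) = n + 1 by omega,
        show n + 1 + 1 + 1 - (0 + 1) = n + 2 by omega]
      ring
  have hgeo : PowerSeries.mk (fun _ => (1 : R)) * (1 - X)
      = 1 := PowerSeries.mk_one_mul_one_sub_eq_one R
  rw [key]
  linear_combination X ^ 4 * u 4 * hgeo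

open PowerSeries in
-- Split by the next letter. All letters from 4 on contribute the same series, and their geometric
-- sum x^4/(1-x) is cleared by the factor 1 - x.
lemma extSeries_system (X' Y' : R) (p q : ℕ) :
    (1 - X) * (extSeries X' Y' p q - 1
      - X * (C (letterWeight X' Y' p q 1) * extSeries X' Y' q 1)
      - X ^ 2 * (C (letterWeight X' Y' p q 2) * extSeries X' Y' q 2)
      - X ^ 3 * (C (letterWeight X' Y' p q 3) * extSeries X' Y' q 3)) =
    X ^ 4 * (C (letterWeight X' Y' p q 4) * extSeries X' Y' q 4) := by
  refine eq_of_coeff_eq_sum (u := fun a => C (letterWeight X' Y' p q a) * extSeries X' Y' q a)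
    (coeff_zero_extSeries _ _ _ _) (fun a ha => ?_) fun n => ?_
  · rw [extSeries_min X' Y' q a, extSeries_min X' Y' q 4, min_eq_left ha, min_self]
    congr 2
    unfold letterWeight
    simp [ha, show 2 ≤ a by omega]
  · rw [coeff_succ_extSeries]
    simp only [coeff_C_mul]

/-- Elimination in the transfer system. -/
lemma transfer_elimination {x X Y A B C D E F G : R}
    (hA : (1 - x) * (A - 1 - x * A - x ^ 2 * B - x ^ 3 * B) = x ^ 4 * E)
    (hB : (1 - x) * (B - 1 - x * A - x ^ 2 * B - x ^ 3 * C) = x ^ 4 * F)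
    (hC : (1 - x) * (C - 1 - x * A - x ^ 2 * B - x ^ 3 * C) = x ^ 4 * (X * F))
    (hD : (1 - x) * (D - 1 - x * A - x ^ 2 * (Y * B) - x ^ 3 * (Y * C)) = x ^ 4 * (X * Y * F))
    (hE : (1 - x) * (E - 1 - x * A - x ^ 2 * B - x ^ 3 * D) = x ^ 4 * G)
    (hF : (1 - x) * (F - 1 - x * A - x ^ 2 * B - x ^ 3 * D) = x ^ 4 * (X * G))
    (hG : (1 - x) * (G - 1 - x * A - x ^ 2 * (Y * B) - x ^ 3 * (Y * D)) = x ^ 4 * (X * Y * G)) :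
    (1 - x) * (A * denom x X Y) = (1 - x) * numer x X Y := by
  unfold denom numer
  -- The multipliers are those for which the unknowns `B`, …, `G` cancel, so that only `A` remains.
  linear_combination -((1 - 3 * x + 2 * x ^ 2 + x ^ 3 - x ^ 4 * X * Y - 2 * x ^ 5
      + 2 * x ^ 5 * X * Y + 2 * x ^ 7 - 2
      * x ^ 7 * X * Y - x ^ 8 + x ^ 8 * X * Y + x ^ 9 - x ^ 9 * Y - x ^ 9 * X + x ^ 9 * X * Y -
      2 * x ^ 10 + 2 * x ^ 10 * Y + 2 * x ^ 10 * X - 2 * x ^ 10 * X * Y + x ^ 11 - x ^ 11 * Y -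
      x ^ 11 * X + x ^ 11 * X * Y) * hA     + (x ^ 2 - 2 * x ^ 3 + x ^ 5 + 2 * x ^ 6 - x ^ 6 * X
      * Y - 2 * x ^ 7 + x ^ 7 * X * Y - x ^ 8 + x ^ 8 * X * Y + x ^ 9 * Y - x ^ 9 * X * Y + 2 *
      x ^ 10 - x ^ 10 * Y - x ^ 10 * X * Y - x ^ 11 + x ^ 11 * X * Y - x ^ 13 * Y + x ^ 13 * Y ^
      2 + x ^ 13 * X * Y - x ^ 13 * X * Y ^ 2 + x ^ 14 * Y - x ^ 14 * Y ^ 2 - x ^ 14 * X * Y + x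
      ^ 14 * X * Y ^ 2) * hB     + (x ^ 5 - 2 * x ^ 6 + 2 * x ^ 8 - x ^ 9 * X * Y - 2 * x ^ 10 +
      x ^ 10 * Y + x ^ 10 * X * Y + x ^ 11 - 2 * x ^ 11 * Y + x ^ 11 * X * Y + 2 * x ^ 12 * Y -
      2 * x ^ 12 * X * Y - 2 * x ^ 14 * Y + x ^ 14 * Y ^ 2 + 2 * x ^ 14 * X * Y - x ^ 14 * X * Y
      ^ 2 + x ^ 15 * Y - x ^ 15 * Y ^ 2 - x ^ 15 * X * Y + x ^ 15 * X * Y ^ 2) * hC     + (x ^ 7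
      - 2 * x ^ 8 + x ^ 9 + x ^ 11 * Y - x ^ 11 * X * Y - x ^ 12 - x ^ 12 * Y + x ^ 12 * X + x ^
      12 * X * Y + x ^ 13 - x ^ 13 * Y - x ^ 13 * X + x ^ 13 * X * Y + x ^ 14 - x ^ 14 * X - x ^
      15 + x ^ 15 * Y + x ^ 15 * X - x ^ 15 * X * Y) * hD     + (x ^ 4 - 2 * x ^ 5 + x ^ 7 + x ^
      8 - x ^ 8 * X * Y - x ^ 9 + x ^ 9 * X * Y - x ^ 10 + x ^ 10 * X * Y + x ^ 11 - x ^ 11 * X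
      * Y + x ^ 13 - x ^ 13 * Y - x ^ 13 * X + x ^ 13 * X * Y - x ^ 14 + x ^ 14 * Y + x ^ 14 * X
      - x ^ 14 * X * Y) * hE     + (x ^ 6 - x ^ 7 - x ^ 8 + x ^ 9 * X + 2 * x ^ 10 - x ^ 10 * X
      - x ^ 10 * X * Y - x ^ 11 * X + x ^ 11 * X * Y - x ^ 12 + x ^ 12 * X - x ^ 13 + x ^ 13 * Y
      + x ^ 13 * X - x ^ 13 * X ^ 2 * Y + x ^ 14 - x ^ 14 * X - x ^ 15 * X * Y + x ^ 15 * X * Y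
      ^ 2 + x ^ 15 * X ^ 2 * Y - x ^ 15 * X ^ 2 * Y ^ 2 - x ^ 17 * Y + x ^ 17 * Y ^ 2 + 2 * x ^
      17 * X * Y - 2 * x ^ 17 * X * Y ^ 2 - x ^ 17 * X ^ 2 * Y + x ^ 17 * X ^ 2 * Y ^ 2) * hF
      + (x ^ 8 - x ^ 9 - x ^ 10 + x ^ 10 * X + x ^ 12 - x ^ 12 * X - x ^ 13 * X + x ^ 13 * X ^ 2
      - x ^ 14 + x ^ 14 * X + x ^ 15 * X - x ^ 15 * X * Y - x ^ 15 * X ^ 2 + x ^ 15 * X ^ 2 * Y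
      + x ^ 17 - x ^ 17 * Y - 2 * x ^ 17 * X + 2 * x ^ 17 * X * Y + x ^ 17 * X ^ 2 - x ^ 17 * X
      ^ 2 * Y) * hG)

open PowerSeries in
/-- The weighted generating function of the compositions is rational. -/
theorem weightSeries_mul_denom (X' Y' : R) :
    weightSeries X' Y' * denom X (C X') (C Y') = numer X (C X') (C Y') := by
  have h := extSeries_system X' Y'
  have hX : ∀ a b : PowerSeries R, (1 - X) * a = (1 - X) * b → a = b := by
    intro a b hab
    have hgeo := PowerSeries.mk_one_mul_one_sub_eq_one R
    linear_combination PowerSeries.mk (fun _ => (1 : R)) * hab - (a - b) * hgeo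
  -- Two pasts with the same last letter and the same weights for the next letter have identical
  -- equations.
  have merge : ∀ p p' q, (∀ r, letterWeight X' Y' p q r = letterWeight X' Y' p' q r) →
      extSeries X' Y' p q = extSeries X' Y' p' q := fun p p' q hw => by
    refine hX _ _ ?_
    have e := h p q
    have e' := h p' q
    simp only [hw] at e
    linear_combination e - e'
  have h1 : ∀ p, extSeries X' Y' p 1 = extSeries X' Y' 1 1 := fun p =>
    merge _ _ _ fun r => by simp [letterWeight]
  have h2 : ∀ p, extSeries X' Y' p 2 = extSeries X' Y' 1 2 := fun p =>
    merge _ _ _ fun r => by simp [letterWeight]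
  have h33 : extSeries X' Y' 3 3
      = extSeries X' Y' 2 3 := merge _ _ _ fun r => by simp [letterWeight]
  have h34 : extSeries X' Y' 3 4
      = extSeries X' Y' 2 4 := merge _ _ _ fun r => by simp [letterWeight]
  -- Here the last letters differ, so `merge` does not apply: the equations agree only after their
  -- successor states have been identified.
  have h13 : extSeries X' Y' 1 3 = extSeries X' Y' 1 2 := by
    refine hX _ _ ?_
    have e := h 1 3
    have e' := h 1 2
    simp only [h1, h2, h33, h34] at e e'
    simp [letterWeight] at e e'
    linear_combination e - e'
  -- Representatives of the seven classes, in the order `A`, …, `G` of `transfer_elimination`.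
  have e1 := h 1 1
  have e2 := h 1 2
  have e3 := h 2 3
  have e4 := h 4 3
  have e5 := h 1 4
  have e6 := h 2 4
  have e7 := h 4 4
  simp only [h1, h2, h33, h34, h13] at e1 e2 e3 e4 e5 e6 e7
  simp [letterWeight] at e1 e2 e3 e4 e5 e6 e7
  rw [← extSeries_one_one]
  exact hX _ _ (transfer_elimination e1 e2 e3 e4 e5 e6 e7)

end Transfer

/-! ### Specialisations and symmetry of the numerator and denominator. -/

section Maps

variable {R S F : Type*} [CommRing R] [CommRing S] [FunLike F R S] [RingHomClass F R S]

lemma map_denom (f : F) (x X Y : R) : f (denom x X Y) = denom (f x) (f X) (f Y) := by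
  simp only [denom, map_add, map_sub, map_mul, map_pow, map_neg, map_one, map_ofNat]

lemma map_numer (f : F) (x X Y : R) : f (numer x X Y) = numer (f x) (f X) (f Y) := by
  simp only [numer, map_add, map_sub, map_mul, map_pow, map_neg, map_one, map_ofNat]

lemma map_avoidDenom (f : F) (x : R) : f (avoidDenom x) = avoidDenom (f x) := by
  simp only [avoidDenom, map_add, map_sub, map_mul, map_pow, map_one, map_ofNat]

lemma map_avoidNumer (f : F) (x : R) : f (avoidNumer x) = avoidNumer (f x) := by
  simp only [avoidNumer, map_add, map_sub, map_mul, map_pow, map_one, map_ofNat]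

/-- The trivariate fraction is not reduced at X = Y = 0: a factor 1 - x cancels against the
numerator. -/
lemma denom_zero_zero (x : R) : denom x 0 0 = -((1 - x) * avoidDenom x) := by
  unfold denom avoidDenom
  ring

lemma numer_zero_zero (x : R) : numer x 0 0 = (1 - x) * avoidNumer x := by
  unfold numer avoidNumer
  ring

lemma denom_swap (x X Y : R) : denom x Y X = denom x X Y := by
  unfold denom
  ring

lemma numer_swap (x X Y : R) : numer x Y X = numer x X Y := by
  unfold numer
  ring

open PowerSeries in
lemma isUnit_denom (X' Y' : R) : IsUnit (denom (X : PowerSeries R) (C X') (C Y')) := by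
  rw [PowerSeries.isUnit_iff_constantCoeff, map_denom]
  simp [denom]

/-- Reversing a composition exchanges 234 and 432. The symmetry is read off from the rational
function instead, and lets every statement about 432 follow from the one about 234. -/
lemma weightSeries_swap (X Y : R) : weightSeries Y X = weightSeries X Y := by
  refine (isUnit_denom X Y).mul_right_cancel ?_
  rw [weightSeries_mul_denom, ← denom_swap, weightSeries_mul_denom, numer_swap]

end Maps

/-! ### The avoiding compositions -/

lemma avoids_iff {n : ℕ} (c : Composition n) {b : List ℕ} (hb : b ≠ []) :
    Avoids c b ↔ occurrences b c = 0 := by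
  rw [occurrences_eq, occCountIn_eq_zero_iff hb]
  rfl

/-- The power 0^k is the indicator of k = 0. -/
lemma avoidSeries_eq : avoidSeries = weightSeries 0 0 := by
  unfold avoidSeries weightSeries
  congr 1
  funext n
  classical
  rw [avoidCount, Nat.card_eq_fintype_card, Fintype.card_subtype, Finset.card_filter,
    Nat.cast_sum]
  refine Finset.sum_congr rfl fun c _ => ?_
  rw [avoids_iff c (by simp), avoids_iff c (by simp)]
  by_cases h1 : occurrences [2, 3, 4] c = 0 <;> by_cases h2 : occurrences [4, 3, 2] c = 0 <;>
    simp [h1, h2]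

lemma avoidSeries_mul_avoidDenom :
    avoidSeries * avoidDenom PowerSeries.X = -avoidNumer PowerSeries.X := by
  have h := weightSeries_mul_denom (0 : ℤ) 0
  rw [map_zero, denom_zero_zero, numer_zero_zero, ← avoidSeries_eq] at h
  have hgeo := PowerSeries.mk_one_mul_one_sub_eq_one ℤ
  linear_combination -PowerSeries.mk (fun _ => (1 : ℤ)) * h
    - (avoidSeries * avoidDenom PowerSeries.X + avoidNumer PowerSeries.X) * hgeo

lemma isUnit_avoidDenom {R : Type*} [CommRing R] :
    IsUnit (avoidDenom (PowerSeries.X : PowerSeries R)) := by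
  rw [PowerSeries.isUnit_iff_constantCoeff, map_avoidDenom]
  simp [avoidDenom]

/-! ### The trivariate generating function -/

section Trivariate

open PowerSeries in
/-- Iterated power series as power series in three variables. -/
noncomputable def flatten : PowerSeries (PowerSeries (PowerSeries ℤ)) →+ MvPowerSeries
    (Fin 3) ℤ where
  toFun F := fun m => coeff (m 2) (coeff (m 1) (coeff (m 0) F))
  map_zero' := by funext m; simp; rfl
  map_add' F G := by funext m; simp; rfl

open PowerSeries in
lemma coeff_flatten (F : PowerSeries (PowerSeries (PowerSeries ℤ))) (m : Fin 3 →₀ ℕ) :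
    MvPowerSeries.coeff m (flatten F) = coeff (m 2) (coeff (m 1) (coeff (m 0) F)) := rfl

/-- The variables of the iterated power series ring. -/
noncomputable def iterVar : Fin 3 → PowerSeries (PowerSeries (PowerSeries ℤ)) :=
  ![PowerSeries.X, PowerSeries.C PowerSeries.X, PowerSeries.C (PowerSeries.C PowerSeries.X)]

open PowerSeries in
lemma coeff_X_mul_eq_ite {S : Type*} [CommRing S] (n : ℕ) (f : PowerSeries S) :
    coeff n (X * f) = if n = 0 then 0 else coeff (n - 1) f := by
  cases n <;> simp [coeff_succ_X_mul]

lemma mvCoeff_X_mul {σ S : Type*} [CommRing S] [DecidableEq σ] (s : σ) (m : σ →₀ ℕ)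
    (f : MvPowerSeries σ S) :
    MvPowerSeries.coeff m (MvPowerSeries.X s * f) =
      if m s = 0 then 0 else MvPowerSeries.coeff (m - Finsupp.single s 1) f := by
  rw [MvPowerSeries.X, MvPowerSeries.coeff_monomial_mul]
  simp only [Finsupp.single_le_iff, one_mul]
  by_cases h : m s = 0
  · simp [h]
  · rw [if_pos (Nat.one_le_iff_ne_zero.2 h), if_neg h]

lemma flatten_iterVar_mul (i : Fin 3) (F : PowerSeries (PowerSeries (PowerSeries ℤ))) :
    flatten (iterVar i * F) = MvPowerSeries.X i * flatten F := by
  ext m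
  rw [mvCoeff_X_mul, coeff_flatten, coeff_flatten]
  fin_cases i
  · simp only [iterVar, Fin.zero_eta, Matrix.cons_val_zero, coeff_X_mul_eq_ite]
    split_ifs <;> simp
  · simp only [iterVar, Fin.mk_one, Matrix.cons_val_one, Matrix.cons_val_zero,
      PowerSeries.coeff_C_mul, coeff_X_mul_eq_ite]
    split_ifs <;> simp
  · simp only [iterVar, Fin.reduceFinMk, Matrix.cons_val, PowerSeries.coeff_C_mul,
      coeff_X_mul_eq_ite]
    split_ifs <;> simp

/-- `flatten` is declared only as an additive map. Compatibility with multiplication by polynomials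
is enough, because the numerator and the denominator are polynomials in the three variables. -/
lemma flatten_aeval_mul (p : MvPolynomial (Fin 3) ℤ) (F : PowerSeries (PowerSeries
    (PowerSeries ℤ))) :
    flatten (MvPolynomial.aeval iterVar p * F) =
      MvPolynomial.aeval (MvPowerSeries.X : Fin 3 → MvPowerSeries (Fin 3) ℤ) p * flatten F := by
  induction p using MvPolynomial.induction_on generalizing F with
  | C a =>
    rw [MvPolynomial.aeval_C, MvPolynomial.aeval_C, eq_intCast, eq_intCast, ← zsmul_eq_mul,
      ← zsmul_eq_mul, map_zsmul]
  | add p q hp hq => simp only [map_add, add_mul, hp, hq]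
  | mul_X p i hp =>
    rw [map_mul (MvPolynomial.aeval iterVar), map_mul (MvPolynomial.aeval _),
      MvPolynomial.aeval_X, MvPolynomial.aeval_X, mul_assoc, hp, flatten_iterVar_mul, mul_assoc]

lemma flatten_one : flatten 1 = 1 := by
  ext m
  rw [coeff_flatten, MvPowerSeries.coeff_one, PowerSeries.coeff_one]
  by_cases h0 : m 0 = 0
  · by_cases h1 : m 1 = 0
    · by_cases h2 : m 2 = 0
      · have : m = 0 := by ext i; fin_cases i <;> simp [h0, h1, h2]
        simp [this]
      · have : m ≠ 0 := fun h => h2 (by simp [h])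
        simp [this, h0, h1, h2, PowerSeries.coeff_one]
    · have : m ≠ 0 := fun h => h1 (by simp [h])
      simp [this, h0, h1, PowerSeries.coeff_one]
  · have : m ≠ 0 := fun h => h0 (by simp [h])
    simp [this, h0]

lemma occSeries_eq : occSeries =
    flatten (weightSeries PowerSeries.X (PowerSeries.C PowerSeries.X)) := by
  ext m
  rw [coeff_flatten, weightSeries, PowerSeries.coeff_mk]
  change (occCount (m 0) (m 1) (m 2) : ℤ) = _
  classical
  rw [occCount, Nat.card_eq_fintype_card, Fintype.card_subtype, Finset.card_filter,
    Nat.cast_sum, map_sum, map_sum]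
  refine Finset.sum_congr rfl fun c _ => ?_
  rw [← map_pow, PowerSeries.coeff_mul_C, PowerSeries.coeff_X_pow]
  by_cases h1 : m 1 = occurrences [2, 3, 4] c
  · by_cases h2 : m 2 = occurrences [4, 3, 2] c
    · simp [h1, h2]
    · simp [h1, Ne.symm h2, PowerSeries.coeff_X_pow, h2]
  · simp [h1, Ne.symm h1]

lemma occSeries_mul_denom :
    occSeries * denom (MvPowerSeries.X 0) (MvPowerSeries.X 1) (MvPowerSeries.X 2) =
      numer (MvPowerSeries.X 0) (MvPowerSeries.X 1) (MvPowerSeries.X 2) := by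
  have h := weightSeries_mul_denom (PowerSeries.X : PowerSeries (PowerSeries ℤ))
    (PowerSeries.C PowerSeries.X)
  have hd := flatten_aeval_mul (denom (MvPolynomial.X 0) (MvPolynomial.X 1) (MvPolynomial.X 2))
    (weightSeries PowerSeries.X (PowerSeries.C PowerSeries.X))
  have hn := flatten_aeval_mul (numer (MvPolynomial.X 0) (MvPolynomial.X 1) (MvPolynomial.X 2)) 1
  simp only [map_denom, map_numer, MvPolynomial.aeval_X, flatten_one, mul_one] at hd hn
  rw [occSeries_eq, mul_comm, ← hd, ← hn, mul_comm (denom _ _ _)]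
  exact congrArg flatten h

lemma isUnit_denom_mvPowerSeries :
    IsUnit (denom (MvPowerSeries.X 0 : MvPowerSeries (Fin 3) ℤ)
        (MvPowerSeries.X 1) (MvPowerSeries.X 2)) := by
  rw [MvPowerSeries.isUnit_iff_constantCoeff, map_denom]
  simp [denom]

end Trivariate

/-! ### Asymptotics of the avoiding compositions -/

lemma mul_mem_Icc_of_nonneg {z t a b c d : ℝ} (hz : z ∈ Set.Icc a b) (ha : 0 ≤ a)
    (ht : t ∈ Set.Icc c d) (hc : 0 ≤ c) : z * t ∈ Set.Icc (a * c) (b * d) :=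
  ⟨mul_le_mul hz.1 ht.1 hc (ha.trans hz.1),
    mul_le_mul hz.2 ht.2 (hc.trans ht.1) (ha.trans (hz.1.trans hz.2))⟩

lemma mul_mem_Icc_of_nonpos {z t a b c d : ℝ} (hz : z ∈ Set.Icc a b) (ha : 0 ≤ a)
    (ht : t ∈ Set.Icc c d) (hd : d ≤ 0) : z * t ∈ Set.Icc (b * c) (a * d) := by
  have h := mul_mem_Icc_of_nonneg hz ha (t := -t) (c := -d) (d := -c)
    ⟨neg_le_neg ht.2, neg_le_neg ht.1⟩ (by linarith)
  exact ⟨by linarith [h.2], by linarith [h.1]⟩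

/-- The derivative of `avoidDenom`. -/
def avoidDenomDeriv (z : ℝ) : ℝ :=
  17 * z ^ 16 + 16 * z ^ 15 + 13 * z ^ 12 + 22 * z ^ 10 - 10 * z ^ 9 + 9 * z ^ 8 - 8 * z ^ 7
    + 7 * z ^ 6 - 10 * z ^ 4 + 4 * z ^ 3 + 4 * z - 3

/-- Eighteen decimals of the root leave room for the twelve decimals claimed for the two constants.
-/
lemma exists_root_avoidDenom : ∃ z ∈ Set.Icc (0.505841755459050037 : ℝ) 0.505841755459050038,
    avoidDenom z = 0 := by
  have hc : ContinuousOn (avoidDenom : ℝ → ℝ)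
      (Set.Icc (0.505841755459050037 : ℝ) 0.505841755459050038) := by
    unfold avoidDenom
    fun_prop
  have h := intermediate_value_Icc' (by norm_num) hc
  exact h ⟨by unfold avoidDenom; norm_num, by unfold avoidDenom; norm_num⟩

open Polynomial in
-- `U` is the denominator divided by 1 - x/z. The bound 7/10 < 1 on its non-constant part at radius
-- 0.55 makes it invertible there by a Neumann-type recursion. Differentiating (z - x) U = z
-- `avoidDenom` at x = z gives the value of `U` at z, which enters the constant C.
lemma exists_quotient {z : ℝ} (hz : z ∈ Set.Icc (0.505841755459050037 : ℝ) 0.505841755459050038)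
    (hD : avoidDenom z = 0) : ∃ U : ℝ[X], (C z - X) * U = C z * avoidDenom X ∧ U.coeff 0 = 1 ∧
      (∀ n, ∑ k ∈ Finset.range n, |U.coeff (k + 1)| * (0.55 : ℝ) ^ (k + 1) ≤ 7 / 10) ∧
      U.eval z = -(z * avoidDenomDeriv z) := by
  have hz' : z ∈ Set.Icc (0.50584 : ℝ) 0.50585 := ⟨by linarith [hz.1], by linarith [hz.2]⟩
  have hpos : (0 : ℝ) ≤ 0.50584 := by norm_num
  -- Synthetic division from the top: if d_k are the coefficients of `avoidDenom`, then u_(k-1) = z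
  -- (u_k - d_k). Each u_k is kept opaque and enclosed in an interval before the next one is formed.
  obtain ⟨u16, h16⟩ : ∃ t, t = -z := ⟨_, rfl⟩
  have b16 : u16 ∈ Set.Icc (-0.50586 : ℝ) (-0.50583) := ⟨by linarith [hz'.2], by linarith [hz'.1]⟩
  obtain ⟨u15, h15⟩ : ∃ t, t = z * (u16 - 1) := ⟨_, rfl⟩
  have b15 : u15 ∈ Set.Icc (-0.76174 : ℝ) (-0.76170) := by
    have h := mul_mem_Icc_of_nonpos hz' hpos (t := u16 - 1) (c := -1.50586) (d := -1.50583)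
      ⟨by linarith [b16.1], by linarith [b16.2]⟩ (by norm_num)
    exact h15 ▸ ⟨le_trans (by norm_num) h.1, h.2.trans (by norm_num)⟩
  obtain ⟨u14, h14⟩ : ∃ t, t = z * (u15) := ⟨_, rfl⟩
  have b14 : u14 ∈ Set.Icc (-0.38533 : ℝ) (-0.38529) := by
    have h := mul_mem_Icc_of_nonpos hz' hpos (t := u15) (c := -0.76174) (d := -0.76170)
      ⟨by linarith [b15.1], by linarith [b15.2]⟩ (by norm_num)
    exact h14 ▸ ⟨le_trans (by norm_num) h.1, h.2.trans (by norm_num)⟩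
  obtain ⟨u13, h13⟩ : ∃ t, t = z * (u14) := ⟨_, rfl⟩
  have b13 : u13 ∈ Set.Icc (-0.19492 : ℝ) (-0.19489) := by
    have h := mul_mem_Icc_of_nonpos hz' hpos (t := u14) (c := -0.38533) (d := -0.38529)
      ⟨by linarith [b14.1], by linarith [b14.2]⟩ (by norm_num)
    exact h13 ▸ ⟨le_trans (by norm_num) h.1, h.2.trans (by norm_num)⟩
  obtain ⟨u12, h12⟩ : ∃ t, t = z * (u13 - 1) := ⟨_, rfl⟩
  have b12 : u12 ∈ Set.Icc (-0.60446 : ℝ) (-0.60442) := by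
    have h := mul_mem_Icc_of_nonpos hz' hpos (t := u13 - 1) (c := -1.19492) (d := -1.19489)
      ⟨by linarith [b13.1], by linarith [b13.2]⟩ (by norm_num)
    exact h12 ▸ ⟨le_trans (by norm_num) h.1, h.2.trans (by norm_num)⟩
  obtain ⟨u11, h11⟩ : ∃ t, t = z * (u12) := ⟨_, rfl⟩
  have b11 : u11 ∈ Set.Icc (-0.30577 : ℝ) (-0.30573) := by
    have h := mul_mem_Icc_of_nonpos hz' hpos (t := u12) (c := -0.60446) (d := -0.60442)
      ⟨by linarith [b12.1], by linarith [b12.2]⟩ (by norm_num)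
    exact h11 ▸ ⟨le_trans (by norm_num) h.1, h.2.trans (by norm_num)⟩
  obtain ⟨u10, h10⟩ : ∃ t, t = z * (u11 - 2) := ⟨_, rfl⟩
  have b10 : u10 ∈ Set.Icc (-1.16638 : ℝ) (-1.16633) := by
    have h := mul_mem_Icc_of_nonpos hz' hpos (t := u11 - 2) (c := -2.30577) (d := -2.30573)
      ⟨by linarith [b11.1], by linarith [b11.2]⟩ (by norm_num)
    exact h10 ▸ ⟨le_trans (by norm_num) h.1, h.2.trans (by norm_num)⟩
  obtain ⟨u9, h9⟩ : ∃ t, t = z * (u10 + 1) := ⟨_, rfl⟩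
  have b9 : u9 ∈ Set.Icc (-0.08417 : ℝ) (-0.08413) := by
    have h := mul_mem_Icc_of_nonpos hz' hpos (t := u10 + 1) (c := -0.16638) (d := -0.16633)
      ⟨by linarith [b10.1], by linarith [b10.2]⟩ (by norm_num)
    exact h9 ▸ ⟨le_trans (by norm_num) h.1, h.2.trans (by norm_num)⟩
  obtain ⟨u8, h8⟩ : ∃ t, t = z * (u9 - 1) := ⟨_, rfl⟩
  have b8 : u8 ∈ Set.Icc (-0.54843 : ℝ) (-0.54839) := by
    have h := mul_mem_Icc_of_nonpos hz' hpos (t := u9 - 1) (c := -1.08417) (d := -1.08413)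
      ⟨by linarith [b9.1], by linarith [b9.2]⟩ (by norm_num)
    exact h8 ▸ ⟨le_trans (by norm_num) h.1, h.2.trans (by norm_num)⟩
  obtain ⟨u7, h7⟩ : ∃ t, t = z * (u8 + 1) := ⟨_, rfl⟩
  have b7 : u7 ∈ Set.Icc (0.22842 : ℝ) (0.22845) := by
    have h := mul_mem_Icc_of_nonneg hz' hpos (t := u8 + 1) (c := 0.45157) (d := 0.45161)
      ⟨by linarith [b8.1], by linarith [b8.2]⟩ (by norm_num)
    exact h7 ▸ ⟨le_trans (by norm_num) h.1, h.2.trans (by norm_num)⟩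
  obtain ⟨u6, h6⟩ : ∃ t, t = z * (u7 - 1) := ⟨_, rfl⟩
  have b6 : u6 ∈ Set.Icc (-0.39031 : ℝ) (-0.39028) := by
    have h := mul_mem_Icc_of_nonpos hz' hpos (t := u7 - 1) (c := -0.77158) (d := -0.77155)
      ⟨by linarith [b7.1], by linarith [b7.2]⟩ (by norm_num)
    exact h6 ▸ ⟨le_trans (by norm_num) h.1, h.2.trans (by norm_num)⟩
  obtain ⟨u5, h5⟩ : ∃ t, t = z * (u6) := ⟨_, rfl⟩
  have b5 : u5 ∈ Set.Icc (-0.19744 : ℝ) (-0.19741) := by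
    have h := mul_mem_Icc_of_nonpos hz' hpos (t := u6) (c := -0.39031) (d := -0.39028)
      ⟨by linarith [b6.1], by linarith [b6.2]⟩ (by norm_num)
    exact h5 ▸ ⟨le_trans (by norm_num) h.1, h.2.trans (by norm_num)⟩
  obtain ⟨u4, h4⟩ : ∃ t, t = z * (u5 + 2) := ⟨_, rfl⟩
  have b4 : u4 ∈ Set.Icc (0.91180 : ℝ) (0.91185) := by
    have h := mul_mem_Icc_of_nonneg hz' hpos (t := u5 + 2) (c := 1.80256) (d := 1.80259)
      ⟨by linarith [b5.1], by linarith [b5.2]⟩ (by norm_num)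
    exact h4 ▸ ⟨le_trans (by norm_num) h.1, h.2.trans (by norm_num)⟩
  obtain ⟨u3, h3⟩ : ∃ t, t = z * (u4 - 1) := ⟨_, rfl⟩
  have b3 : u3 ∈ Set.Icc (-0.04462 : ℝ) (-0.04458) := by
    have h := mul_mem_Icc_of_nonpos hz' hpos (t := u4 - 1) (c := -0.08820) (d := -0.08815)
      ⟨by linarith [b4.1], by linarith [b4.2]⟩ (by norm_num)
    exact h3 ▸ ⟨le_trans (by norm_num) h.1, h.2.trans (by norm_num)⟩
  obtain ⟨u2, h2⟩ : ∃ t, t = z * (u3) := ⟨_, rfl⟩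
  have b2 : u2 ∈ Set.Icc (-0.02258 : ℝ) (-0.02255) := by
    have h := mul_mem_Icc_of_nonpos hz' hpos (t := u3) (c := -0.04462) (d := -0.04458)
      ⟨by linarith [b3.1], by linarith [b3.2]⟩ (by norm_num)
    exact h2 ▸ ⟨le_trans (by norm_num) h.1, h.2.trans (by norm_num)⟩
  obtain ⟨u1, h1⟩ : ∃ t, t = z * (u2 - 2) := ⟨_, rfl⟩
  have b1 : u1 ∈ Set.Icc (-1.02313 : ℝ) (-1.02308) := by
    have h := mul_mem_Icc_of_nonpos hz' hpos (t := u2 - 2) (c := -2.02258) (d := -2.02255)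
      ⟨by linarith [b2.1], by linarith [b2.2]⟩ (by norm_num)
    exact h1 ▸ ⟨le_trans (by norm_num) h.1, h.2.trans (by norm_num)⟩
  have hz0 : z ≠ 0 := (lt_of_lt_of_le (by norm_num) hz'.1).ne'
  -- The last step of the division returns the constant term 1; this is the equation `avoidDenom z =
  -- 0`.
  have h0 : z * (u1 + 3) = 1 := by
    unfold avoidDenom at hD
    simp only [h1, h2, h3, h4, h5, h6, h7, h8, h9, h10, h11, h12, h13, h14, h15, h16]
    linear_combination -hD
  set U : ℝ[X] := 1 + C u1 * X + C u2 * X ^ 2 + C u3 * X ^ 3 + C u4 * X ^ 4 + C u5 * X ^ 5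
      + C u6 * X ^ 6 + C u7 * X ^ 7 + C u8 * X ^ 8 + C u9 * X ^ 9 + C u10 * X ^ 10
      + C u11 * X ^ 11 + C u12 * X ^ 12 + C u13 * X ^ 13 + C u14 * X ^ 14 + C u15 * X ^ 15
      + C u16 * X ^ 16 with hU
  have hcoeff : ∀ n, U.coeff n =
      ([1, u1, u2, u3, u4, u5, u6, u7, u8, u9, u10, u11, u12, u13, u14, u15, u16] : List ℝ).getD n 0 := by
    intro n
    rcases Nat.lt_or_ge n 17 with hn | hn
    · interval_cases n <;> simp [hU, coeff_X_pow, coeff_X, coeff_one]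
    · rw [List.getD_eq_default _ _ (by simpa using hn)]
      refine coeff_eq_zero_of_natDegree_lt (lt_of_le_of_lt ?_ hn)
      rw [hU]
      compute_degree
  refine ⟨U, ?_, by simp [hcoeff], fun n => ?_, ?_⟩
  · unfold avoidDenom
    rw [hU]
    have e0 := congrArg C h0
    have e1 := congrArg C h1
    have e2 := congrArg C h2
    have e3 := congrArg C h3
    have e4 := congrArg C h4
    have e5 := congrArg C h5
    have e6 := congrArg C h6
    have e7 := congrArg C h7
    have e8 := congrArg C h8
    have e9 := congrArg C h9
    have e10 := congrArg C h10
    have e11 := congrArg C h11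
    have e12 := congrArg C h12
    have e13 := congrArg C h13
    have e14 := congrArg C h14
    have e15 := congrArg C h15
    have e16 := congrArg C h16
    simp only [map_mul, map_add, map_sub, map_neg, map_one, map_ofNat] at e0 e1 e2 e3 e4 e5 e6 e7 e8 e9 e10 e11 e12 e13 e14 e15 e16
    linear_combination X * e0 - (X ^ 2 * e1 + X ^ 3 * e2 + X ^ 4 * e3 + X ^ 5 * e4 + X ^ 6 * e5
        + X ^ 7 * e6 + X ^ 8 * e7 + X ^ 9 * e8 + X ^ 10 * e9 + X ^ 11 * e10 + X ^ 12 * e11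
        + X ^ 13 * e12 + X ^ 14 * e13 + X ^ 15 * e14 + X ^ 16 * e15 + X ^ 17 * e16)
  · refine le_trans (?_ : _ ≤ ∑ k ∈ Finset.range 16, |U.coeff (k + 1)| * (0.55 : ℝ) ^ (k + 1)) ?_
    · rcases le_total n 16 with hn | hn
      · exact Finset.sum_le_sum_of_subset_of_nonneg (Finset.range_mono hn)
          fun _ _ _ => by positivity
      · refine (Finset.sum_subset (Finset.range_mono hn) fun k _ hk => ?_).ge
        rw [hcoeff, List.getD_eq_default _ _ (by simp at hk ⊢; omega)]
        simp
    · simp only [hcoeff, Finset.sum_range_succ, Finset.sum_range_zero]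
      simp only [List.getD_cons_succ, List.getD_cons_zero, zero_add, Nat.reduceAdd]
      have a1 := abs_le.2 (⟨by linarith [b1.1], by linarith [b1.2]⟩ : -(1.02313 : ℝ) ≤ u1
          ∧ u1 ≤ 1.02313)
      have a2 := abs_le.2 (⟨by linarith [b2.1], by linarith [b2.2]⟩ : -(0.02258 : ℝ) ≤ u2
          ∧ u2 ≤ 0.02258)
      have a3 := abs_le.2 (⟨by linarith [b3.1], by linarith [b3.2]⟩ : -(0.04462 : ℝ) ≤ u3
          ∧ u3 ≤ 0.04462)
      have a4 := abs_le.2 (⟨by linarith [b4.1], by linarith [b4.2]⟩ : -(0.91185 : ℝ) ≤ u4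
          ∧ u4 ≤ 0.91185)
      have a5 := abs_le.2 (⟨by linarith [b5.1], by linarith [b5.2]⟩ : -(0.19744 : ℝ) ≤ u5
          ∧ u5 ≤ 0.19744)
      have a6 := abs_le.2 (⟨by linarith [b6.1], by linarith [b6.2]⟩ : -(0.39031 : ℝ) ≤ u6
          ∧ u6 ≤ 0.39031)
      have a7 := abs_le.2 (⟨by linarith [b7.1], by linarith [b7.2]⟩ : -(0.22845 : ℝ) ≤ u7
          ∧ u7 ≤ 0.22845)
      have a8 := abs_le.2 (⟨by linarith [b8.1], by linarith [b8.2]⟩ : -(0.54843 : ℝ) ≤ u8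
          ∧ u8 ≤ 0.54843)
      have a9 := abs_le.2 (⟨by linarith [b9.1], by linarith [b9.2]⟩ : -(0.08417 : ℝ) ≤ u9
          ∧ u9 ≤ 0.08417)
      have a10 := abs_le.2 (⟨by linarith [b10.1], by linarith [b10.2]⟩ : -(1.16638 : ℝ) ≤ u10
          ∧ u10 ≤ 1.16638)
      have a11 := abs_le.2 (⟨by linarith [b11.1], by linarith [b11.2]⟩ : -(0.30577 : ℝ) ≤ u11
          ∧ u11 ≤ 0.30577)
      have a12 := abs_le.2 (⟨by linarith [b12.1], by linarith [b12.2]⟩ : -(0.60446 : ℝ) ≤ u12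
          ∧ u12 ≤ 0.60446)
      have a13 := abs_le.2 (⟨by linarith [b13.1], by linarith [b13.2]⟩ : -(0.19492 : ℝ) ≤ u13
          ∧ u13 ≤ 0.19492)
      have a14 := abs_le.2 (⟨by linarith [b14.1], by linarith [b14.2]⟩ : -(0.38533 : ℝ) ≤ u14
          ∧ u14 ≤ 0.38533)
      have a15 := abs_le.2 (⟨by linarith [b15.1], by linarith [b15.2]⟩ : -(0.76174 : ℝ) ≤ u15
          ∧ u15 ≤ 0.76174)
      have a16 := abs_le.2 (⟨by linarith [b16.1], by linarith [b16.2]⟩ : -(0.50586 : ℝ) ≤ u16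
          ∧ u16 ≤ 0.50586)
      norm_num only
      linarith
  · unfold avoidDenom at hD
    simp only [hU, eval_add, eval_mul, eval_C, eval_pow, eval_X, eval_one, avoidDenomDeriv]
    simp only [h1, h2, h3, h4, h5, h6, h7, h8, h9, h10, h11, h12, h13, h14, h15, h16]
    linear_combination hD

open PowerSeries in
/-- Division by a series that is a small perturbation of `1` preserves geometric bounds. -/
lemma abs_coeff_mul_pow_le_of_mul_eq {U b r : PowerSeries ℝ} {ρ θ K : ℝ} (hρ : 0 ≤ ρ) (hθ : θ < 1)
    (h0 : coeff 0 U = 1)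
    (hU : ∀ n, ∑ k ∈ Finset.range n, |coeff (k + 1) U| * ρ ^ (k + 1) ≤ θ)
    (hK : ∀ n, |coeff n r| * ρ ^ n ≤ K) (h : b * U = r) (n : ℕ) :
    |coeff n b| * ρ ^ n ≤ K / (1 - θ) := by
  have hK0 : 0 ≤ K := (by positivity : (0 : ℝ) ≤ |coeff 0 r| * ρ ^ 0).trans (hK 0)
  have h1 : 0 < 1 - θ := by linarith
  induction n using Nat.strong_induction_on with
  | _ n ih =>
    -- Solving for the top term gives a recursion with contraction factor `θ`; the bound K/(1-θ) is
    -- its fixed point K + θ K/(1-θ).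
    have e : coeff n b = coeff n r
        - ∑ k ∈ Finset.range n, coeff (k + 1) U * coeff (n - (k + 1)) b := by
      rw [← h, mul_comm, coeff_mul, Finset.Nat.sum_antidiagonal_eq_sum_range_succ_mk,
        Finset.sum_range_succ']
      simp [h0]
    have e2 : |coeff n b| * ρ ^ n ≤ |coeff n r| * ρ ^ n + ∑ k ∈ Finset.range n,
        (|coeff (k + 1) U| * ρ ^ (k + 1)) * (|coeff (n - (k + 1)) b| * ρ ^ (n - (k + 1))) := by
      have e3 : ∑ k ∈ Finset.range n,
          (|coeff (k + 1) U| * ρ ^ (k + 1)) * (|coeff (n - (k + 1)) b| * ρ ^ (n - (k + 1)))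
          = (∑ k ∈ Finset.range n, |coeff (k + 1) U * coeff (n - (k + 1)) b|) * ρ ^ n := by
        rw [Finset.sum_mul]
        refine Finset.sum_congr rfl fun k hk => ?_
        have hk := Finset.mem_range.1 hk
        rw [abs_mul, show ρ ^ n = ρ ^ (k + 1) * ρ ^ (n - (k + 1)) by
          rw [← pow_add]; congr 1; omega]
        ring
      rw [e3, ← add_mul, e]
      refine mul_le_mul_of_nonneg_right ?_ (by positivity)
      exact (abs_sub _ _).trans (add_le_add le_rfl (Finset.abs_sum_le_sum_abs _ _))
    have e4 : ∑ k ∈ Finset.range n,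
        (|coeff (k + 1) U| * ρ ^ (k + 1)) * (|coeff (n - (k + 1)) b| * ρ ^ (n - (k + 1)))
        ≤ θ * (K / (1 - θ)) := by
      refine le_trans (Finset.sum_le_sum fun k hk => mul_le_mul_of_nonneg_left
        (ih (n - (k + 1)) (by have := Finset.mem_range.1 hk; omega)) (by positivity)) ?_
      rw [← Finset.sum_mul]
      exact mul_le_mul_of_nonneg_right (hU n) (by positivity)
    have e5 : K + θ * (K / (1 - θ)) = K / (1 - θ) := by
      field_simp
      ring
    linarith [hK n]

/-- The coefficients of a polynomial satisfy every geometric bound. -/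
lemma exists_abs_coeff_mul_pow_le (p : Polynomial ℝ) {ρ : ℝ} (hρ : 0 ≤ ρ) :
    ∃ K, ∀ n, |p.coeff n| * ρ ^ n ≤ K := by
  refine ⟨∑ k ∈ p.support, |p.coeff k| * ρ ^ k, fun n => ?_⟩
  by_cases hn : n ∈ p.support
  · exact Finset.single_le_sum (f := fun k => |p.coeff k| * ρ ^ k)
      (fun _ _ => by positivity) hn
  · rw [Polynomial.notMem_support_iff.1 hn]
    simp only [abs_zero, zero_mul]
    exact Finset.sum_nonneg fun _ _ => by positivity

open PowerSeries in
lemma coe_avoidDenom : ((avoidDenom Polynomial.X : Polynomial ℝ) : PowerSeries ℝ)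
    = avoidDenom X := by
  have := map_avoidDenom (Polynomial.coeToPowerSeries.ringHom (R := ℝ)) Polynomial.X
  simpa using this

open PowerSeries in
lemma coe_avoidNumer : ((avoidNumer Polynomial.X : Polynomial ℝ) : PowerSeries ℝ)
    = avoidNumer X := by
  have := map_avoidNumer (Polynomial.coeToPowerSeries.ringHom (R := ℝ)) Polynomial.X
  simpa using this

open PowerSeries in
/-- Separation of the dominant simple pole. -/
lemma isEquivalent_coeff_of_pole {A : PowerSeries ℝ} {U N : Polynomial ℝ} {z ρ θ : ℝ} (hz : 0 < z)
    (hzρ : z < ρ) (hθ : θ < 1) (h0 : U.coeff 0 = 1)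
    (hU : ∀ n, ∑ k ∈ Finset.range n, |U.coeff (k + 1)| * ρ ^ (k + 1) ≤ θ)
    (hUz : U.eval z ≠ 0) (hNz : N.eval z ≠ 0)
    (h : (C z - X) * (A * (U : PowerSeries ℝ)) = C z * (N : PowerSeries ℝ)) :
    (fun n => coeff n A) ~[atTop] fun n => (N.eval z / U.eval z) * z⁻¹ ^ n := by
  set c := N.eval z / U.eval z with hc
  have hρ : 0 < ρ := hz.trans hzρ
  -- The choice of `c` makes N - c U vanish at z, so subtracting c times the geometric series `G`
  -- removes the pole, and what remains is a polynomial divided by `U`.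
  obtain ⟨r, hr⟩ : (Polynomial.X - Polynomial.C z) ∣ N - Polynomial.C c * U := by
    rw [Polynomial.dvd_iff_isRoot, Polynomial.IsRoot.def, Polynomial.eval_sub, Polynomial.eval_mul,
      Polynomial.eval_C, hc, div_mul_cancel₀ _ hUz, sub_self]
  set G : PowerSeries ℝ := PowerSeries.mk fun n => z⁻¹ ^ n with hG
  have hGz : (C z - X) * G = C z := by
    ext n
    rw [sub_mul, map_sub, coeff_C_mul]
    cases n with
    | zero => simp [hG]
    | succ n =>
      rw [coeff_succ_X_mul]
      simp [hG, pow_succ]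
      field_simp
      simp
  have hr' : (N : PowerSeries ℝ) - C c * (U : PowerSeries ℝ) = (X - C z) * (r : PowerSeries ℝ) := by
    have := congrArg (fun p : Polynomial ℝ => (p : PowerSeries ℝ)) hr
    simpa using this
  have hne : (C z - X : PowerSeries ℝ) ≠ 0 := fun h0 => by
    have := congrArg (coeff 0) h0
    simp at this
    exact hz.ne' this
  have hb : (A - C c * G) * (U : PowerSeries ℝ) =
      ((-(Polynomial.C z * r) : Polynomial ℝ) : PowerSeries ℝ) := by
    refine mul_left_cancel₀ hne ?_
    simp only [Polynomial.coe_neg, Polynomial.coe_mul, Polynomial.coe_C]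
    linear_combination h - C c * U * hGz + C z * hr'
  obtain ⟨K, hK⟩ := exists_abs_coeff_mul_pow_le (-(Polynomial.C z * r)) hρ.le
  have hbound := abs_coeff_mul_pow_le_of_mul_eq (U := (U : PowerSeries ℝ)) hρ.le hθ
    (by simpa using h0) (by simpa using hU)
    (by simpa only [Polynomial.coeff_coe] using hK) hb
  have hc0 : c ≠ 0 := div_ne_zero hNz hUz
  rw [isEquivalent_iff_tendsto_one (Eventually.of_forall fun n => by positivity)]
  have hlim : Tendsto (fun n => coeff n (A - C c * G) / (c * z⁻¹ ^ n)) atTop (𝓝 0) := by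
    have hg : Tendsto (fun n : ℕ => K / (1 - θ) / |c| * (z / ρ) ^ n) atTop (𝓝 0) := by
      have := (tendsto_pow_atTop_nhds_zero_of_lt_one (by positivity)
        ((div_lt_one hρ).2 hzρ)).const_mul (K / (1 - θ) / |c|)
      simpa using this
    refine squeeze_zero_norm (fun n => ?_) hg
    rw [Real.norm_eq_abs, abs_div, abs_mul, abs_pow, abs_of_pos (inv_pos.2 hz)]
    have := hbound n
    rw [div_le_iff₀ (by positivity)]
    have e : K / (1 - θ) / |c| * (z / ρ) ^ n * (|c| * z⁻¹ ^ n) = K / (1 - θ) / ρ ^ n := by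
      have : |c| ≠ 0 := by positivity
      rw [div_pow, inv_pow]
      field_simp
    rw [e, le_div_iff₀ (by positivity)]
    exact this
  have := hlim.add_const 1
  rw [zero_add] at this
  refine this.congr fun n => ?_
  have : c * z⁻¹ ^ n ≠ 0 := by positivity
  rw [Pi.div_apply, map_sub, coeff_C_mul, hG, coeff_mk]
  field_simp
  ring

lemma avoidCount_isEquivalent : ∃ C α : ℝ, (0.548269839581 ≤ C ∧ C < 0.548269839582) ∧
    (1.976902834153 ≤ α ∧ α < 1.976902834154) ∧
    (fun n : ℕ => (avoidCount n : ℝ)) ~[atTop] fun n => C * α ^ n := by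
  obtain ⟨z, hz, hD⟩ := exists_root_avoidDenom
  obtain ⟨U, hU, hU0, hUs, hUz⟩ := exists_quotient hz hD
  have hz0 : 0 < z := lt_of_lt_of_le (by norm_num) hz.1
  -- Each power of z is enclosed separately, so that the bounds on C become linear inequalities in
  -- these powers.
  have hpow : ∀ k : ℕ, (0.505841755459050037 : ℝ) ^ k ≤ z ^ k ∧ z ^ k ≤ 0.505841755459050038 ^ k :=
    fun k => ⟨pow_le_pow_left₀ (by norm_num) hz.1 k, pow_le_pow_left₀ hz0.le hz.2 k⟩
  have p1 := hpow 1
  have p2 := hpow 2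
  have p3 := hpow 3
  have p4 := hpow 4
  have p5 := hpow 5
  have p6 := hpow 6
  have p7 := hpow 7
  have p8 := hpow 8
  have p9 := hpow 9
  have p10 := hpow 10
  have p11 := hpow 11
  have p12 := hpow 12
  have p13 := hpow 13
  have p15 := hpow 15
  have p16 := hpow 16
  have p17 := hpow 17
  norm_num only at p1 p2 p3 p4 p5 p6 p7 p8 p9 p10 p11 p12 p13 p15 p16 p17
  have hW : U.eval z = -(17 * z ^ 17 + 16 * z ^ 16 + 13 * z ^ 13 + 22 * z ^ 11 - 10 * z ^ 10
      + 9 * z ^ 9 - 8 * z ^ 8 + 7 * z ^ 7 - 10 * z ^ 5 + 4 * z ^ 4 + 4 * z ^ 2 - 3 * z) := by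
    rw [hUz, avoidDenomDeriv]
    ring
  have hN : (-avoidNumer Polynomial.X : Polynomial ℝ).eval z = -avoidNumer z := by
    simp [avoidNumer]
  have hUpos : 0 < U.eval z := by
    rw [hW]
    linarith [p1.1, p1.2]
  have hNpos : 0 < (-avoidNumer Polynomial.X : Polynomial ℝ).eval z := by
    rw [hN, avoidNumer]
    linarith
  refine ⟨(-avoidNumer Polynomial.X : Polynomial ℝ).eval z / U.eval z, z⁻¹, ⟨?_, ?_⟩, ⟨?_, ?_⟩, ?_⟩
  · rw [le_div_iff₀ hUpos, hN, hW, avoidNumer]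
    linarith
  · rw [div_lt_iff₀ hUpos, hN, hW, avoidNumer]
    linarith
  · rw [le_inv_comm₀ (by norm_num) hz0]
    exact hz.2.trans (by norm_num)
  · rw [inv_lt_comm₀ hz0 (by norm_num)]
    exact lt_of_lt_of_le (by norm_num) hz.1
  · have hmap : PowerSeries.map (Int.castRingHom ℝ) avoidSeries * avoidDenom PowerSeries.X
        = -avoidNumer PowerSeries.X := by
      have := congrArg (PowerSeries.map (Int.castRingHom ℝ)) avoidSeries_mul_avoidDenom
      rwa [map_mul, map_avoidDenom, map_neg, map_avoidNumer, PowerSeries.map_X] at this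
    have hU' : (PowerSeries.C z - PowerSeries.X) * (U : PowerSeries ℝ)
        = PowerSeries.C z * avoidDenom PowerSeries.X := by
      have := congrArg (fun p : Polynomial ℝ => (p : PowerSeries ℝ)) hU
      simpa [coe_avoidDenom] using this
    have key := isEquivalent_coeff_of_pole (A := PowerSeries.map (Int.castRingHom ℝ) avoidSeries)
      (U := U) (N := -avoidNumer Polynomial.X) (z := z) (ρ := 0.55) (θ := 7 / 10) hz0
      (lt_of_le_of_lt hz.2 (by norm_num)) (by norm_num) hU0 hUs hUpos.ne' hNpos.ne' (by
        rw [Polynomial.coe_neg, coe_avoidNumer]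
        linear_combination PowerSeries.map (Int.castRingHom ℝ) avoidSeries * hU'
          + PowerSeries.C z * hmap)
    refine key.congr_left (Eventually.of_forall fun n => ?_)
    simp [avoidSeries]

/-! ### Changing which variable of a two-variable series is outermost. -/

section Swap

open PowerSeries

variable {R : Type*} [CommRing R]

/-- Exchange of the two variables of an iterated power series. -/
noncomputable def swapHom : PowerSeries (PowerSeries R) →+* PowerSeries (PowerSeries R) where
  toFun F := PowerSeries.mk fun k => PowerSeries.mk fun n => coeff k (coeff n F)
  map_zero' := by ext; simp
  map_add' F G := by ext; simp
  map_one' := by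
    ext k n
    simp only [coeff_mk, coeff_one]
    split_ifs <;> simp_all [coeff_one]
  map_mul' F G := by
    ext k n
    simp only [coeff_mk, coeff_mul, map_sum]
    exact Finset.sum_comm

lemma coeff_coeff_swapHom (F : PowerSeries (PowerSeries R)) (k n : ℕ) :
    coeff n (coeff k (swapHom F)) = coeff k (coeff n F) := by
  simp [swapHom]

lemma swapHom_X : swapHom (X : PowerSeries (PowerSeries R)) = C X := by
  ext k n
  rw [coeff_coeff_swapHom, coeff_X, coeff_C]
  split_ifs <;> simp_all [coeff_X, coeff_one]

lemma swapHom_C (f : PowerSeries R) : swapHom (C f) = PowerSeries.map C f := by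
  ext k n
  rw [coeff_coeff_swapHom, coeff_C, coeff_map, coeff_C]
  split_ifs <;> simp

lemma swapHom_C_X : swapHom (C (X : PowerSeries R)) = X := by
  rw [swapHom_C, map_X]

end Swap

/-! ### First and second moments -/

section Moments

open PowerSeries

/-- The generating function of the weighted sums of the `k`-th binomial moments of
`a` times the number of `234` plus `b` times the number of `432`. -/
noncomputable def binomSeries (a b k : ℕ) : PowerSeries ℝ :=
  coeff k (swapHom (weightSeries ((1 + X : PowerSeries ℝ) ^ a) ((1 + X) ^ b)))

lemma coeff_one_add_X_pow (N k : ℕ) : coeff k ((1 + X : PowerSeries ℝ) ^ N) = N.choose k := by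
  have := Polynomial.coeff_one_add_X_pow ℝ N k
  rw [← this, ← Polynomial.coeff_coe]
  simp

lemma coeff_binomSeries (a b k n : ℕ) : coeff n (binomSeries a b k) =
    ∑ c : Composition n,
      ((a * occurrences [2, 3, 4] c + b * occurrences [4, 3, 2] c).choose k : ℝ) := by
  rw [binomSeries, coeff_coeff_swapHom, weightSeries, coeff_mk, map_sum]
  refine Finset.sum_congr rfl fun c _ => ?_
  rw [← pow_mul, ← pow_mul, ← pow_add, coeff_one_add_X_pow]

lemma binomSeries_swap (a b k : ℕ) : binomSeries b a k = binomSeries a b k := by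
  rw [binomSeries, weightSeries_swap, binomSeries]

lemma swapHom_weightSeries_mul (P Q : PowerSeries ℝ) :
    swapHom (weightSeries P Q) * denom (C X) (swapHom (C P)) (swapHom (C Q)) =
      numer (C X) (swapHom (C P)) (swapHom (C Q)) := by
  have := congrArg swapHom (weightSeries_mul_denom P Q)
  rwa [map_mul, map_denom, map_numer, swapHom_X] at this

/-- Comparison of the first three coefficients in an identity of power series. -/
lemma coeff_relations {S : Type*} [CommRing S] {F D N : PowerSeries S} {d₀ d₁ d₂ n₀ n₁ n₂ : S}
    (h : F * (C d₀ + C d₁ * X + C d₂ * X ^ 2 + D * X ^ 3) =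
      C n₀ + C n₁ * X + C n₂ * X ^ 2 + N * X ^ 3) :
    coeff 0 F * d₀ = n₀ ∧ coeff 0 F * d₁ + coeff 1 F * d₀ = n₁ ∧
      coeff 0 F * d₂ + coeff 1 F * d₁ + coeff 2 F * d₀ = n₂ := by
  have h' : F * C d₀ + X * (F * C d₁) + X ^ 2 * (F * C d₂) + X ^ 3 * (F * D) =
      C n₀ + X * C n₁ + X ^ 2 * C n₂ + X ^ 3 * N := by linear_combination h
  have h0 := congrArg (coeff 0) h'
  have h1 := congrArg (coeff 1) h'
  have h2 := congrArg (coeff 2) h'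
  simp only [map_add, coeff_X_pow_mul', coeff_X_mul_eq_ite, coeff_mul_C, coeff_C] at h0 h1 h2
  norm_num at h0 h1 h2
  refine ⟨by simpa using h0, ?_, ?_⟩
  · simp only [coeff_zero_eq_constantCoeff]
    linear_combination h1
  · rw [coeff_X, if_neg (by norm_num)] at h2
    simp only [coeff_zero_eq_constantCoeff]
    linear_combination h2

/-- The first two orders of the perturbed system. -/
lemma solve_relations {S : Type*} [CommRing S] [IsDomain S] {x f₀ f₁ f₂ d₁ d₂ n₁ n₂ p₁ p₂ : S}
    (hx : 1 - x ≠ 0) (h0 : f₀ * (-1 + 4 * x - 5 * x ^ 2 + 2 * x ^ 3) = -1 + 3 * x - 3 * x ^ 2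
        + x ^ 3)
    (h1 : f₀ * d₁ + f₁ * (-1 + 4 * x - 5 * x ^ 2 + 2 * x ^ 3) = n₁)
    (h2 : f₀ * d₂ + f₁ * d₁ + f₂ * (-1 + 4 * x - 5 * x ^ 2 + 2 * x ^ 3) = n₂)
    (hp₁ : (1 - 2 * x) * n₁ - (1 - x) * d₁ = -((1 - x) * p₁))
    (hp₂ : (1 - 2 * x) ^ 2 * (1 - x) * n₂ - (1 - 2 * x) * (1 - x) ^ 2 * d₂ - p₁ * d₁ =
      -((1 - x) * p₂)) :
    f₁ * ((1 - 2 * x) ^ 2 * (1 - x)) = p₁ ∧ f₂ * ((1 - 2 * x) ^ 3 * (1 - x) ^ 2) = p₂ := by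
  -- The unperturbed denominator is -(1-2x)(1-x)^2 and the numerator -(1-x)^3, so order zero is the
  -- series (1-x)/(1-2x) of all compositions.
  have e0 : f₀ * (1 - 2 * x) = 1 - x := by
    refine mul_left_cancel₀ (pow_ne_zero 2 hx) ?_
    linear_combination -h0
  have e1 : f₁ * ((1 - 2 * x) ^ 2 * (1 - x)) = p₁ := by
    refine mul_left_cancel₀ hx ?_
    linear_combination -(1 - 2 * x) * h1 + d₁ * e0 - hp₁
  refine ⟨e1, mul_left_cancel₀ hx ?_⟩
  linear_combination -(1 - 2 * x) ^ 2 * (1 - x) * h2 + (1 - 2 * x) * (1 - x) * d₂ * e0 + d₁ * e1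
      - hp₂

lemma one_sub_X_ne_zero : (1 - X : PowerSeries ℝ) ≠ 0 := fun h => by
  have := congrArg (coeff 0) h
  simp at this

lemma one_sub_two_mul_X_ne_zero : (1 - 2 * X : PowerSeries ℝ) ≠ 0 := fun h => by
  have := congrArg (coeff 0) h
  simp at this

/-- The binomial moment series of the number of occurrences of `234`. -/
lemma binomSeries_one_zero :
    binomSeries 1 0 1 * ((1 - 2 * X) ^ 2 * (1 - X)) = X ^ 9 ∧
    binomSeries 1 0 2 * ((1 - 2 * X) ^ 3 * (1 - X) ^ 2) =
      X ^ 13 - 2 * X ^ 14 + X ^ 16 - X ^ 17 := by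
  have h := swapHom_weightSeries_mul ((1 + X : PowerSeries ℝ) ^ 1) ((1 + X) ^ 0)
  simp only [pow_one, pow_zero, map_add, map_one, swapHom_C_X] at h
  -- At Y = 1 the terms quadratic in X cancel in numerator and denominator, hence the zeros for
  -- `d₂`, `D`, `n₂` and `N`.
  obtain ⟨h0, h1, h2⟩ := coeff_relations (S := PowerSeries ℝ)
    (F := swapHom (weightSeries (1 + X) 1))
    (d₀ := -1 + 4 * X - 5 * X ^ 2 + 2 * X ^ 3)
    (d₁ := X ^ 4 - 3 * X ^ 5 + 2 * X ^ 6 + X ^ 7 - 2 * X ^ 8 + X ^ 9)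
    (d₂ := 0) (D := 0) (n₀ := -1 + 3 * X - 3 * X ^ 2 + X ^ 3)
    (n₁ := X ^ 4 - 2 * X ^ 5 + X ^ 6 + X ^ 7 - X ^ 8) (n₂ := 0) (N := 0) (by
      simp only [map_add, map_sub, map_neg, map_mul, map_pow, map_one, map_ofNat, map_zero]
      unfold denom numer at h
      linear_combination h)
  simp only [binomSeries, pow_one, pow_zero]
  exact solve_relations one_sub_X_ne_zero h0 h1 h2 (by ring) (by ring)

/-- The binomial moment series of the total number of occurrences of both patterns. -/
lemma binomSeries_one_one :
    binomSeries 1 1 1 * ((1 - 2 * X) ^ 2 * (1 - X)) = 2 * X ^ 9 ∧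
    binomSeries 1 1 2 * ((1 - 2 * X) ^ 3 * (1 - X) ^ 2) = X ^ 11 - 2 * X ^ 12 + 2 * X ^ 13
      - 2 * X ^ 14 - 3 * X ^ 15 + 2 * X ^ 16 - 4 * X ^ 17 := by
  have h := swapHom_weightSeries_mul ((1 + X : PowerSeries ℝ) ^ 1) ((1 + X) ^ 1)
  simp only [pow_one, map_add, map_one, swapHom_C_X] at h
  obtain ⟨h0, h1, h2⟩ := coeff_relations (S := PowerSeries ℝ)
    (F := swapHom (weightSeries (1 + X) (1 + X)))
    (d₀ := -1 + 4 * X - 5 * X ^ 2 + 2 * X ^ 3)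
    (d₁ := 2 * X ^ 4 - 6 * X ^ 5 + 4 * X ^ 6 + 2 * X ^ 7 - 4 * X ^ 8 + 2 * X ^ 9)
    (d₂ := X ^ 4 - 3 * X ^ 5 + 2 * X ^ 6 + X ^ 7 - 2 * X ^ 8 + 2 * X ^ 10 - 3 * X ^ 11
      + 2 * X ^ 12 - X ^ 13 - X ^ 14)
    (D := -2 * C X ^ 14 + (C X ^ 18 - C X ^ 16) * X) (n₀ := -1 + 3 * X - 3 * X ^ 2 + X ^ 3)
    (n₁ := 2 * X ^ 4 - 4 * X ^ 5 + 2 * X ^ 6 + 2 * X ^ 7 - 2 * X ^ 8)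
    (n₂ := X ^ 4 - 2 * X ^ 5 + X ^ 6 + X ^ 7 - X ^ 8 + 2 * X ^ 10 - 2 * X ^ 11 + X ^ 12 + X ^ 13)
    (N := 2 * C X ^ 13 + (C X ^ 15 - C X ^ 17) * X) (by
      simp only [map_add, map_sub, map_neg, map_mul, map_pow, map_one, map_ofNat]
      unfold denom numer at h
      linear_combination h)
  simp only [binomSeries, pow_one]
  exact solve_relations one_sub_X_ne_zero h0 h1 h2 (by ring) (by ring)

lemma mk_two_pow_mul : (PowerSeries.mk fun n => (2 : ℝ) ^ n) * (1 - 2 * X) = 1 := by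
  ext n
  rw [show (PowerSeries.mk fun n => (2 : ℝ) ^ n) * (1 - 2 * X) = PowerSeries.mk (fun n =>
      (2 : ℝ) ^ n)
    - X * (C 2 * PowerSeries.mk fun n => (2 : ℝ) ^ n) by rw [map_ofNat]; ring]
  cases n with
  | zero => simp
  | succ n => simp [coeff_succ_X_mul, coeff_one, pow_succ, mul_comm]

lemma mk_succ_mul_two_pow_mul : (PowerSeries.mk fun n => ((n : ℝ) + 1) * 2 ^ n) * (1 - 2 * X) ^ 2
    = 1 := by
  have : (PowerSeries.mk fun n => ((n : ℝ) + 1) * 2 ^ n) * (1 - 2 * X) =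
      PowerSeries.mk fun n => (2 : ℝ) ^ n := by
    ext n
    rw [show (PowerSeries.mk fun n => ((n : ℝ) + 1) * 2 ^ n) * (1 - 2 * X) =
      PowerSeries.mk (fun n => ((n : ℝ) + 1) * 2 ^ n)
      - X * (C 2 * PowerSeries.mk fun n => ((n : ℝ) + 1) * 2 ^ n) by rw [map_ofNat]; ring]
    cases n with
    | zero => simp
    | succ n =>
      rw [map_sub, coeff_succ_X_mul, coeff_C_mul, coeff_mk, coeff_mk, coeff_mk]
      push_cast
      ring
  rw [pow_two, ← mul_assoc, this, mk_two_pow_mul]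

lemma mk_choose_mul_two_pow_mul :
    (PowerSeries.mk fun n => ((n : ℝ) + 1) * (n + 2) / 2 * 2 ^ n) * (1 - 2 * X) ^ 3 = 1 := by
  have : (PowerSeries.mk fun n => ((n : ℝ) + 1) * (n + 2) / 2 * 2 ^ n) * (1 - 2 * X) =
      PowerSeries.mk fun n => ((n : ℝ) + 1) * 2 ^ n := by
    ext n
    rw [show (PowerSeries.mk fun n => ((n : ℝ) + 1) * (n + 2) / 2 * 2 ^ n) * (1 - 2 * X) =
      PowerSeries.mk (fun n => ((n : ℝ) + 1) * (n + 2) / 2 * 2 ^ n)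
      - X * (C 2 * PowerSeries.mk fun n => ((n : ℝ) + 1) * (n + 2) / 2 * 2 ^ n) by
        rw [map_ofNat]; ring]
    cases n with
    | zero => simp
    | succ n =>
      rw [map_sub, coeff_succ_X_mul, coeff_C_mul, coeff_mk, coeff_mk, coeff_mk]
      push_cast
      ring
  rw [pow_succ', ← mul_assoc, this, mk_succ_mul_two_pow_mul]

lemma mk_succ_mul : (PowerSeries.mk fun n => (n : ℝ) + 1) * (1 - X) ^ 2 = 1 := by
  have : (PowerSeries.mk fun n => (n : ℝ) + 1) * (1 - X) = PowerSeries.mk 1 := by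
    ext n
    rw [mul_one_sub]
    cases n with
    | zero => simp
    | succ n => simp [coeff_succ_mul_X]
  rw [pow_two, ← mul_assoc, this, PowerSeries.mk_one_mul_one_sub_eq_one]

/-- Coefficients of a rational function from its partial fraction decomposition. -/
lemma coeff_of_partial_fractions {f p : PowerSeries ℝ} {P : Polynomial ℝ} {m c₃ c₂ c₁ b₂ b₁ : ℝ}
    (h : f * ((1 - 2 * X) ^ 3 * (1 - X) ^ 2) = p)
    (hp : C m * p = C c₃ * (1 - X) ^ 2 + C c₂ * ((1 - 2 * X) * (1 - X) ^ 2)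
      + C c₁ * ((1 - 2 * X) ^ 2 * (1 - X) ^ 2) + C b₂ * (1 - 2 * X) ^ 3
      + C b₁ * ((1 - 2 * X) ^ 3 * (1 - X)) + Polynomial.coeToPowerSeries.ringHom P * ((1
          - 2 * X) ^ 3 * (1 - X) ^ 2))
    {n : ℕ} (hn : P.natDegree < n) :
    m * coeff n f = c₃ * (((n : ℝ) + 1) * (n + 2) / 2 * 2 ^ n) + c₂ * (((n : ℝ) + 1) * 2 ^ n)
      + c₁ * 2 ^ n + b₂ * ((n : ℝ) + 1) + b₁ := by
  have e : C m * f = C c₃ * (PowerSeries.mk fun n => ((n : ℝ) + 1) * (n + 2) / 2 * 2 ^ n)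
      + C c₂ * (PowerSeries.mk fun n => ((n : ℝ) + 1) * 2 ^ n)
      + C c₁ * (PowerSeries.mk fun n => (2 : ℝ) ^ n)
      + C b₂ * (PowerSeries.mk fun n => (n : ℝ) + 1) + C b₁ * PowerSeries.mk 1
      + Polynomial.coeToPowerSeries.ringHom P := by
    refine mul_right_cancel₀ (mul_ne_zero (pow_ne_zero 3 one_sub_two_mul_X_ne_zero)
      (pow_ne_zero 2 one_sub_X_ne_zero)) ?_
    linear_combination C m * h + hp - C c₃ * (1 - X) ^ 2 * mk_choose_mul_two_pow_mul
      - C c₂ * ((1 - 2 * X) * (1 - X) ^ 2) * mk_succ_mul_two_pow_mul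
      - C c₁ * ((1 - 2 * X) ^ 2 * (1 - X) ^ 2) * mk_two_pow_mul
      - C b₂ * (1 - 2 * X) ^ 3 * mk_succ_mul
      - C b₁ * ((1 - 2 * X) ^ 3 * (1 - X)) * PowerSeries.mk_one_mul_one_sub_eq_one ℝ
  have e' := congrArg (coeff n) e
  simp only [map_add, coeff_C_mul, coeff_mk, Polynomial.coeToPowerSeries.ringHom_apply,
    Polynomial.coeff_coe,
    Polynomial.coeff_eq_zero_of_natDegree_lt hn, Pi.one_apply] at e'
  linarith

/-- The numerator is multiplied by (1-2x)(1-x) to reach the common denominator of the second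
moments. The threshold 13 is also theirs: their polynomial parts have degree 12. -/
lemma coeff_of_mul_eq_X_pow_nine {f : PowerSeries ℝ}
    (h : f * ((1 - 2 * X) ^ 2 * (1 - X)) = X ^ 9) {n : ℕ} (hn : 13 ≤ n) :
    coeff n f = 2 ^ n * ((n : ℝ) - 9) / 256 + 1 := by
  have := coeff_of_partial_fractions (f := f) (p := X ^ 9 * ((1 - 2 * X) * (1 - X)))
    (P := -247 - 240 * Polynomial.X - 228 * Polynomial.X ^ 2 - 208 * Polynomial.X ^ 3
        - 176 * Polynomial.X ^ 4 - 128 * Polynomial.X ^ 5 - 64 * Polynomial.X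
      ^ 6)
    (m := 256) (c₃ := 0) (c₂ := 1) (c₁ := -10) (b₂ := 0) (b₁ := 256) (n := n)
    (by linear_combination (1 - 2 * X) * (1 - X) * h)
    (by
      simp only [map_sub, map_mul, map_pow, map_zero, map_neg, map_one, map_ofNat,
        Polynomial.coeToPowerSeries.ringHom_apply, Polynomial.coe_X]
      ring)
    (lt_of_le_of_lt (b := 12) (by compute_degree!) hn)
  linarith

lemma coeff_binomSeries_one_zero_two {n : ℕ} (hn : 13 ≤ n) :
    32768 * coeff n (binomSeries 1 0 2) = ((n : ℝ) + 1) * (n + 2) / 2 * 2 ^ n - ((n : ℝ)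
        + 1) * 2 ^ n
      - 103 * 2 ^ n + 32768 * ((n : ℝ) + 1) - 327680 := by
  have := coeff_of_partial_fractions binomSeries_one_zero.2
    (P := 295015 + 262348 * Polynomial.X + 229776 * Polynomial.X ^ 2 + 197384 * Polynomial.X ^ 3
        + 165328 * Polynomial.X ^ 4 + 133888
      * Polynomial.X ^ 5 + 103552 * Polynomial.X ^ 6 + 75136 * Polynomial.X ^ 7
          + 49920 * Polynomial.X ^ 8 + 29696 * Polynomial.X ^ 9 + 16384
      * Polynomial.X ^ 10 + 10240 * Polynomial.X ^ 11 + 4096 * Polynomial.X ^ 12)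
    (m := 32768) (c₃ := 1) (c₂ := -1) (c₁ := -103) (b₂ := 32768) (b₁ := -327680) (n := n)
    (by
      simp only [map_add, map_mul, map_pow, map_neg, map_one, map_ofNat,
        Polynomial.coeToPowerSeries.ringHom_apply, Polynomial.coe_X]
      ring)
    (lt_of_le_of_lt (b := 12) (by compute_degree!) hn)
  linarith

lemma coeff_binomSeries_one_one_two {n : ℕ} (hn : 13 ≤ n) :
    8192 * coeff n (binomSeries 1 1 2) = ((n : ℝ) + 1) * (n + 2) / 2 * 2 ^ n
      + 12 * (((n : ℝ) + 1) * 2 ^ n) - 272 * 2 ^ n + 49152 * ((n : ℝ) + 1) - 491520 := by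
  have := coeff_of_partial_fractions binomSeries_one_one.2
    (P := 442627 + 393706 * Polynomial.X + 344984 * Polynomial.X ^ 2 + 296624 * Polynomial.X ^ 3
        + 248912 * Polynomial.X ^ 4 + 202336
      * Polynomial.X ^ 5 + 157696 * Polynomial.X ^ 6 + 116224 * Polynomial.X ^ 7
          + 79616 * Polynomial.X ^ 8 + 49664 * Polynomial.X ^ 9 +
      26624 * Polynomial.X ^ 10 + 12288 * Polynomial.X ^ 11 + 4096 * Polynomial.X ^ 12)
    (m := 8192) (c₃ := 1) (c₂ := 12) (c₁ := -272) (b₂ := 49152) (b₁ := -491520) (n := n)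
    (by
      simp only [map_add, map_mul, map_pow, map_neg, map_one, map_ofNat,
        Polynomial.coeToPowerSeries.ringHom_apply, Polynomial.coe_X]
      ring)
    (lt_of_le_of_lt (b := 12) (by compute_degree!) hn)
  linarith

end Moments

/-! ### Algebra of means, variances and covariances under the uniform distribution. -/

section Mean

variable {n : ℕ} (f g : Composition n → ℝ)

lemma card_composition_pos : (0 : ℝ) < Fintype.card (Composition n) := by
  rw [composition_card]
  positivity

lemma mean_add : mean n (fun c => f c + g c) = mean n f + mean n g := by
  simp only [mean, Finset.sum_add_distrib, add_div]

lemma mean_sub : mean n (fun c => f c - g c) = mean n f - mean n g := by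
  simp only [mean, Finset.sum_sub_distrib, sub_div]

lemma mean_const_mul (a : ℝ) : mean n (fun c => a * f c) = a * mean n f := by
  simp only [mean, ← Finset.mul_sum, mul_div_assoc]

lemma mean_const (a : ℝ) : mean n (fun _ => a) = a := by
  have := card_composition_pos (n := n)
  simp only [mean, Finset.sum_const, nsmul_eq_mul, Finset.card_univ]
  field_simp

lemma mean_sum {ι : Type*} (s : Finset ι) (F : ι → Composition n → ℝ) :
    mean n (fun c => ∑ i ∈ s, F i c) = ∑ i ∈ s, mean n (F i) := by
  simp only [mean, ← Finset.sum_div]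
  rw [Finset.sum_comm]

lemma cov_eq : cov n f g = mean n (fun c => f c * g c) - mean n f * mean n g := by
  have e : (fun c => (f c - mean n f) * (g c - mean n g)) =
      fun c => (f c * g c - mean n f * g c) - (mean n g * f c - mean n f * mean n g) := by
    funext c
    ring
  rw [cov, e, mean_sub, mean_sub, mean_sub, mean_const_mul, mean_const_mul, mean_const]
  ring

lemma var_eq_cov : var n f = cov n f f := by
  simp only [var, cov, pow_two]

lemma var_eq : var n f = mean n (fun c => f c ^ 2) - mean n f ^ 2 := by
  simp only [var_eq_cov, cov_eq, pow_two]

/-- There are 2^(n-1) compositions; for n = 0 the truncated exponent would spoil the factor 2. -/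
lemma mean_eq_of_pos (hn : 0 < n) : mean n f = 2 * (∑ c, f c) / 2 ^ n := by
  rw [mean, composition_card]
  obtain ⟨m, rfl⟩ := Nat.exists_eq_succ_of_ne_zero hn.ne'
  push_cast
  have e : (2 : ℝ) ^ m.succ = 2 * 2 ^ (m.succ - 1) := by
    simp only [Nat.succ_eq_add_one, Nat.add_sub_cancel]
    ring
  rw [e, mul_div_mul_left _ _ two_ne_zero]
  rfl

end Mean

lemma cast_choose_two' (N : ℕ) : (N : ℝ) ^ 2 = 2 * (N.choose 2 : ℝ) + N := by
  rw [Nat.cast_choose_two]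
  ring

/-- Mean and variance from the first two binomial moments. -/
lemma mean_var_of_sums {n : ℕ} (hn : 0 < n) (N : Composition n → ℕ) {s₁ s₂ : ℝ}
    (h1 : ∑ c, ((N c).choose 1 : ℝ) = s₁) (h2 : ∑ c, ((N c).choose 2 : ℝ) = s₂) :
    mean n (fun c => (N c : ℝ)) = 2 * s₁ / 2 ^ n ∧
    var n (fun c => (N c : ℝ)) = 2 * (2 * s₂ + s₁) / 2 ^ n - (2 * s₁ / 2 ^ n) ^ 2 := by
  simp only [Nat.choose_one_right] at h1
  have hm : mean n (fun c => (N c : ℝ)) = 2 * s₁ / 2 ^ n := by rw [mean_eq_of_pos _ hn, h1]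
  refine ⟨hm, ?_⟩
  rw [var_eq, hm, mean_eq_of_pos _ hn]
  simp only [cast_choose_two', Finset.sum_add_distrib, ← Finset.mul_sum, h1, h2]

lemma sum_choose_occurrences {b : List ℕ} (hb : b = [2, 3, 4] ∨ b = [4, 3, 2]) (k n : ℕ) :
    ∑ c : Composition n, ((occurrences b c).choose k : ℝ) =
      PowerSeries.coeff n (binomSeries 1 0 k) := by
  rcases hb with rfl | rfl
  · simp [coeff_binomSeries]
  · rw [← binomSeries_swap]
    simp [coeff_binomSeries]

lemma mean_var_occ {b : List ℕ} (hb : b = [2, 3, 4] ∨ b = [4, 3, 2]) {n : ℕ} (hn : 13 ≤ n) :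
    mean n (occ b n) = ((n : ℝ) - 9) / 128 + 2 / 2 ^ n ∧
    var n (occ b n) = 147 / 16384 * (n : ℝ) - 1439 / 16384
      + (127 / 32 * (n : ℝ) - 1079 / 32) / 2 ^ n - 4 / 4 ^ n := by
  have h := mean_var_of_sums (by omega) (fun c : Composition n => occurrences b c)
    (sum_choose_occurrences hb 1 n) (sum_choose_occurrences hb 2 n)
  have e1 := coeff_of_mul_eq_X_pow_nine binomSeries_one_zero.1 hn
  have e2 := coeff_binomSeries_one_zero_two hn
  have h4 : (4 : ℝ) ^ n = 2 ^ n * 2 ^ n := by rw [← mul_pow]; norm_num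
  have e2' : PowerSeries.coeff n (binomSeries 1 0 2) = (((n : ℝ) + 1) * (n + 2) / 2 * 2 ^ n
      - ((n : ℝ) + 1) * 2 ^ n - 103 * 2 ^ n + 32768 * ((n : ℝ) + 1) - 327680) / 32768 := by
    rw [← e2]
    ring
  have hpos : (2 : ℝ) ^ n ≠ 0 := by positivity
  rw [e1, e2'] at h
  constructor
  · refine h.1.trans ?_
    field_simp
    ring
  · refine h.2.trans ?_
    rw [h4]
    field_simp
    ring

lemma var_add {n : ℕ} (f g : Composition n → ℝ) :
    var n (fun c => f c + g c) = var n f + var n g + 2 * cov n f g := by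
  have e : (fun c => (f c + g c) ^ 2) = fun c => (f c ^ 2 + g c ^ 2) + 2 * (f c * g c) := by
    funext c
    ring
  rw [var_eq, var_eq, var_eq, cov_eq, mean_add, e, mean_add, mean_add, mean_const_mul]
  ring

/-- Polarisation: the covariance is half of what the variance of the total count has in excess of
the two individual variances. -/
lemma cov_occ {n : ℕ} (hn : 13 ≤ n) :
    cov n (occ [2, 3, 4] n) (occ [4, 3, 2] n) = 71 / 16384 * (n : ℝ) - 911 / 16384
      + (255 / 32 * (n : ℝ) - 2295 / 32) / 2 ^ n - 4 / 4 ^ n := by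
  have hT := (mean_var_of_sums (by omega)
    (fun c : Composition n => 1 * occurrences [2, 3, 4] c + 1 * occurrences [4, 3, 2] c)
    (coeff_binomSeries 1 1 1 n).symm (coeff_binomSeries 1 1 2 n).symm).2
  have hA := (mean_var_occ (Or.inl rfl) hn).2
  have hB := (mean_var_occ (Or.inr rfl) hn).2
  have e1 : PowerSeries.coeff n (binomSeries 1 1 1) = 2 * (2 ^ n * ((n : ℝ) - 9) / 256 + 1) := by
    -- The series of the total mean is twice that of a single pattern, so its half falls under the
    -- same lemma.
    rw [← coeff_of_mul_eq_X_pow_nine (f := PowerSeries.C (1 / 2) * binomSeries 1 1 1) ?_ hn]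
    · simp
    · rw [mul_assoc, binomSeries_one_one.1, ← mul_assoc, ← map_ofNat PowerSeries.C 2, ← map_mul]
      norm_num
  have e2 := coeff_binomSeries_one_one_two hn
  have e2' : PowerSeries.coeff n (binomSeries 1 1 2) = (((n : ℝ) + 1) * (n + 2) / 2 * 2 ^ n
      + 12 * (((n : ℝ) + 1) * 2 ^ n) - 272 * 2 ^ n + 49152 * ((n : ℝ) + 1) - 491520) / 8192 := by
    rw [← e2]
    ring
  have hsum := var_add (occ [2, 3, 4] n) (occ [4, 3, 2] n)
  have e : (fun c => occ [2, 3, 4] n c + occ [4, 3, 2] n c) = fun c : Composition n =>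
      ((1 * occurrences [2, 3, 4] c + 1 * occurrences [4, 3, 2] c : ℕ) : ℝ) := by
    funext c
    simp [occ]
  rw [e, hT, hA, hB, e1, e2'] at hsum
  have h4 : (4 : ℝ) ^ n = 2 ^ n * 2 ^ n := by rw [← mul_pow]; norm_num
  rw [h4] at hsum ⊢
  have hpos : (2 : ℝ) ^ n ≠ 0 := by positivity
  have h2 : cov n (occ [2, 3, 4] n) (occ [4, 3, 2] n) = 1 / 2 * (2 * cov n (occ [2, 3, 4] n)
    (occ [4, 3, 2] n)) := by ring
  rw [h2, eq_sub_of_add_eq' hsum.symm]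
  field_simp
  ring

/-! ### Expectation, variance, correlation -/

lemma tendsto_div_two_pow : Tendsto (fun n : ℕ => (n : ℝ) / 2 ^ n) atTop (𝓝 0) :=
  tendsto_pow_const_div_const_pow_of_one_lt 1 (by norm_num : (1 : ℝ) < 2) |>.congr fun n => by simp

lemma one_isBigO_cast : (fun _ : ℕ => (1 : ℝ)) =O[atTop] fun n : ℕ => (n : ℝ) :=
  (isBigO_const_left_iff_pos_le_norm (by norm_num)).2 ⟨1, by norm_num, by
    filter_upwards [eventually_ge_atTop 1] with n hn
    simpa using hn⟩

lemma affine_div_two_pow_isBigO (a b c : ℝ) :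
    (fun n : ℕ => (a * (n : ℝ) + b) / 2 ^ n + c / 4 ^ n) =O[atTop] fun n => (n : ℝ) / 2 ^ n := by
  have h1 : (fun n : ℕ => (a * (n : ℝ) + b + c / 2 ^ n)) =O[atTop] fun n => (n : ℝ) := by
    refine (((isBigO_refl _ _).const_mul_left a).add ?_).add ?_
    · simpa using one_isBigO_cast.const_mul_left b
    · refine IsBigO.trans (IsBigO.of_bound |c| (Eventually.of_forall fun n => ?_)) one_isBigO_cast
      rw [norm_div, Real.norm_eq_abs, norm_one, mul_one]
      refine div_le_self (abs_nonneg _) ?_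
      rw [Real.norm_eq_abs, abs_of_pos (by positivity)]
      exact one_le_pow₀ (by norm_num)
  have h2 := h1.mul (isBigO_refl (fun n : ℕ => ((2 : ℝ) ^ n)⁻¹) atTop)
  refine h2.congr_left fun n => ?_
  have h4 : (4 : ℝ) ^ n = 2 ^ n * 2 ^ n := by rw [← mul_pow]; norm_num
  rw [h4]
  field_simp

lemma tendsto_affine_div {u : ℕ → ℝ} {a b : ℝ}
    (h : (fun n : ℕ => u n - (a * (n : ℝ) + b)) =O[atTop] fun n => (n : ℝ) / 2 ^ n) :
    Tendsto (fun n : ℕ => u n / n) atTop (𝓝 a) := by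
  have h0 : Tendsto (fun n : ℕ => u n - (a * (n : ℝ) + b)) atTop (𝓝 0) :=
    h.trans_tendsto tendsto_div_two_pow
  have h1 := ((h0.add_const b).mul tendsto_inv_atTop_nhds_zero_nat).add_const a
  rw [mul_zero, zero_add] at h1
  refine h1.congr' ?_
  filter_upwards [eventually_gt_atTop 0] with n hn
  have : (n : ℝ) ≠ 0 := by positivity
  field_simp
  ring

lemma mean_occ_isBigO {b : List ℕ} (hb : b = [2, 3, 4] ∨ b = [4, 3, 2]) :
    (fun n : ℕ => mean n (occ b n) - ((n : ℝ) - 9) / 128)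
    =O[atTop] fun n => (n : ℝ) / 2 ^ n := by
  refine (affine_div_two_pow_isBigO 0 2 0).congr' ?_ EventuallyEq.rfl
  filter_upwards [eventually_ge_atTop 13] with n hn
  rw [(mean_var_occ hb hn).1]
  ring

lemma var_occ_isBigO {b : List ℕ} (hb : b = [2, 3, 4] ∨ b = [4, 3, 2]) :
    (fun n : ℕ => var n (occ b n) - (147 / 16384 * (n : ℝ) - 1439 / 16384))
    =O[atTop] fun n => (n : ℝ) / 2 ^ n := by
  refine (affine_div_two_pow_isBigO (127 / 32) (-1079 / 32) (-4)).congr' ?_ EventuallyEq.rfl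
  filter_upwards [eventually_ge_atTop 13] with n hn
  rw [(mean_var_occ hb hn).2]
  ring

lemma tendsto_mean_occ_div {b : List ℕ} (hb : b = [2, 3, 4] ∨ b = [4, 3, 2]) : Tendsto
    (fun n : ℕ => mean n (occ b n) / n) atTop (𝓝 (1 / 128)) :=
  tendsto_affine_div (b := -9 / 128) ((mean_occ_isBigO hb).congr_left fun n => by ring)

lemma tendsto_var_occ_div {b : List ℕ} (hb : b = [2, 3, 4] ∨ b = [4, 3, 2]) :
    Tendsto (fun n : ℕ => var n (occ b n) / n) atTop (𝓝 (147 / 16384)) :=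
  tendsto_affine_div (b := -1439 / 16384) ((var_occ_isBigO hb).congr_left fun n => by ring)

lemma mean_occ_isEquivalent {b : List ℕ} (hb : b = [2, 3, 4] ∨ b = [4, 3, 2]) :
    (fun n : ℕ => mean n (occ b n)) ~[atTop] fun n => (n : ℝ) / 128 := by
  rw [isEquivalent_iff_tendsto_one (by
    filter_upwards [eventually_gt_atTop 0] with n hn
    positivity)]
  have := (tendsto_mean_occ_div hb).mul_const 128
  rw [one_div, inv_mul_cancel₀ (by norm_num)] at this
  refine this.congr fun n => ?_
  rw [Pi.div_apply]
  field_simp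

lemma tendsto_cov_occ_div :
    Tendsto (fun n : ℕ => cov n (occ [2, 3, 4] n) (occ [4, 3, 2] n) / n) atTop
      (𝓝 (71 / 16384)) := by
  refine tendsto_affine_div (b := -911 / 16384) ?_
  refine (affine_div_two_pow_isBigO (255 / 32) (-2295 / 32) (-4)).congr' ?_ EventuallyEq.rfl
  filter_upwards [eventually_ge_atTop 13] with n hn
  rw [cov_occ hn]
  ring

lemma tendsto_corr_occ : Tendsto (fun n : ℕ => corr n (occ [2, 3, 4] n) (occ [4, 3, 2] n)) atTop
    (𝓝 (71 / 147)) := by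
  have h1 := (tendsto_var_occ_div (Or.inl rfl)).sqrt
  have h2 := (tendsto_var_occ_div (Or.inr rfl)).sqrt
  have h := tendsto_cov_occ_div.div (h1.mul h2) (by positivity)
  rw [Real.mul_self_sqrt (by norm_num)] at h
  norm_num at h
  refine h.congr' ?_
  filter_upwards [eventually_gt_atTop 0] with n hn
  have hn' : (0 : ℝ) < n := by positivity
  rw [Pi.div_apply, corr, div_mul_div_comm, Real.mul_self_sqrt hn'.le, div_div_div_cancel_right₀ hn'.ne']

/-! ### Power series with polynomially bounded coefficients -/

section Growth

open PowerSeries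

/-- Power series whose coefficients grow at most polynomially. -/
def polyGrowth : Subring (PowerSeries ℝ) where
  carrier := {f | ∃ (K : ℝ) (d : ℕ), ∀ n, |coeff n f| ≤ K * ((n : ℝ) + 1) ^ d}
  mul_mem' := by
    rintro f g ⟨K, d, hf⟩ ⟨L, e, hg⟩
    have hK : 0 ≤ K := by simpa using (abs_nonneg _).trans (hf 0)
    have hL : 0 ≤ L := by simpa using (abs_nonneg _).trans (hg 0)
    -- The additional exponent pays for the n + 1 terms of the convolution.
    refine ⟨K * L, d + e + 1, fun n => ?_⟩
    rw [coeff_mul]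
    have hb : ∀ p ∈ Finset.HasAntidiagonal.antidiagonal n, |coeff p.1 f * coeff p.2 g| ≤
        (K * ((n : ℝ) + 1) ^ d) * (L * ((n : ℝ) + 1) ^ e) := by
      intro p hp
      have hp := Finset.HasAntidiagonal.mem_antidiagonal.1 hp
      have h1 : (p.1 : ℝ) ≤ n := by exact_mod_cast (by omega : p.1 ≤ n)
      have h2 : (p.2 : ℝ) ≤ n := by exact_mod_cast (by omega : p.2 ≤ n)
      rw [abs_mul]
      have h3 := (hf p.1).trans (by gcongr : _ ≤ K * ((n : ℝ) + 1) ^ d)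
      have h4 := (hg p.2).trans (by gcongr : _ ≤ L * ((n : ℝ) + 1) ^ e)
      exact mul_le_mul h3 h4 (abs_nonneg _) (by positivity)
    refine (Finset.abs_sum_le_sum_abs _ _).trans ((Finset.sum_le_card_nsmul _ _ _ hb).trans ?_)
    rw [Finset.Nat.card_antidiagonal, nsmul_eq_mul]
    push_cast
    apply le_of_eq
    ring
  one_mem' := ⟨1, 0, fun n => by
    rw [coeff_one]
    split_ifs <;> simp⟩
  add_mem' := by
    rintro f g ⟨K, d, hf⟩ ⟨L, e, hg⟩
    have hK : 0 ≤ K := by simpa using (abs_nonneg _).trans (hf 0)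
    have hL : 0 ≤ L := by simpa using (abs_nonneg _).trans (hg 0)
    refine ⟨K + L, d + e, fun n => ?_⟩
    have h1 : (1 : ℝ) ≤ (n : ℝ) + 1 := by simp
    rw [map_add, add_mul]
    refine (abs_add_le _ _).trans (add_le_add ((hf n).trans ?_) ((hg n).trans ?_))
    · exact mul_le_mul_of_nonneg_left (pow_le_pow_right₀ h1 (by omega)) hK
    · exact mul_le_mul_of_nonneg_left (pow_le_pow_right₀ h1 (by omega)) hL
  zero_mem' := ⟨0, 0, fun n => by simp⟩
  neg_mem' := by
    rintro f ⟨K, d, hf⟩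
    exact ⟨K, d, fun n => by simpa using hf n⟩

lemma C_mem_polyGrowth (a : ℝ) : C a ∈ polyGrowth := ⟨|a|, 0, fun n => by
  rw [coeff_C]
  split_ifs <;> simp⟩

lemma mk_one_mem_polyGrowth : (PowerSeries.mk 1 : PowerSeries ℝ) ∈ polyGrowth :=
  ⟨1, 0, fun n => by simp⟩

lemma mem_polyGrowth_of_eventually_zero {f : PowerSeries ℝ} {N : ℕ}
    (h : ∀ n, N ≤ n → coeff n f = 0) : f ∈ polyGrowth := by
  refine ⟨∑ k ∈ Finset.range N, |coeff k f|, 0, fun n => ?_⟩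
  rw [pow_zero, mul_one]
  rcases lt_or_ge n N with hn | hn
  · exact Finset.single_le_sum (f := fun k => |coeff k f|) (fun _ _ => abs_nonneg _)
      (Finset.mem_range.2 hn)
  · rw [h n hn, abs_zero]
    exact Finset.sum_nonneg fun _ _ => abs_nonneg _

lemma coeff_swapHom_coe_mem_polyGrowth (p : Polynomial (PowerSeries ℝ)) (k : ℕ) :
    coeff k (swapHom (p : PowerSeries (PowerSeries ℝ))) ∈ polyGrowth := by
  refine mem_polyGrowth_of_eventually_zero (N := p.natDegree + 1) fun n hn => ?_
  rw [coeff_coeff_swapHom, Polynomial.coeff_coe, Polynomial.coeff_eq_zero_of_natDegree_lt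
      (by omega),
    map_zero]

/-- Division by a perturbation of `2 * (1 - X) ^ 2` preserves polynomial growth. -/
lemma coeff_mem_polyGrowth_of_mul_eq {E V r : PowerSeries (PowerSeries ℝ)} (h : E * V = r)
    (hV0 : coeff 0 V = C 2 * (1 - X) ^ 2) (hV : ∀ k, coeff k V ∈ polyGrowth)
    (hr : ∀ k, coeff k r ∈ polyGrowth) (k : ℕ) : coeff k E ∈ polyGrowth := by
  induction k using Nat.strong_induction_on with
  | _ k ih =>
    -- The system is triangular in the order k: each order costs one division by 2(1-x)^2, whose
    -- inverse has polynomially growing coefficients.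
    have e : coeff k E * coeff 0 V = coeff k r
        - ∑ j ∈ Finset.range k, coeff (k - (j + 1)) E * coeff (j + 1) V := by
      rw [← h, mul_comm E V, coeff_mul, Finset.Nat.sum_antidiagonal_eq_sum_range_succ_mk,
        Finset.sum_range_succ']
      simp only [Nat.sub_zero, mul_comm]
      ring
    have hgeo := PowerSeries.mk_one_mul_one_sub_eq_one ℝ
    have hC : (C (1 / 2) * C 2 : PowerSeries ℝ) = 1 := by rw [← map_mul]; norm_num
    have e2 : coeff k E = C (1 / 2) * PowerSeries.mk 1 ^ 2 * (coeff k r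
        - ∑ j ∈ Finset.range k, coeff (k - (j + 1)) E * coeff (j + 1) V) := by
      rw [← e, hV0]
      linear_combination -coeff k E * (PowerSeries.mk 1 ^ 2 * (1 - X) ^ 2) * hC
        - coeff k E * (PowerSeries.mk 1 * (1 - X) + 1) * hgeo
    rw [e2]
    refine mul_mem (mul_mem (C_mem_polyGrowth _) (pow_mem mk_one_mem_polyGrowth 2)) (sub_mem (hr k)
      (sum_mem fun j hj => mul_mem (ih _ ?_) (hV _)))
    have := Finset.mem_range.1 hj
    omega

end Growth

/-! ### The dominant pole -/

section Pole

open Polynomial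

lemma isUnit_of_constantCoeff_ne_zero {f : PowerSeries ℝ}
    (h : PowerSeries.constantCoeff f ≠ 0) : IsUnit f :=
  PowerSeries.isUnit_iff_constantCoeff.2 (isUnit_iff_ne_zero.2 h)

lemma constantCoeff_eval (p : (PowerSeries ℝ)[X]) (a : PowerSeries ℝ) :
    PowerSeries.constantCoeff (p.eval a) = (p.map (PowerSeries.constantCoeff (R := ℝ))).eval
        (PowerSeries.constantCoeff a) := by
  rw [eval_map, eval₂_at_apply]

/-- The root of a perturbation of `-(1 - 2 * X) * (1 - X) ^ 2` near `1 / 2`. -/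
lemma exists_root_of_perturbation {p : (PowerSeries ℝ)[X]} {N : ℕ} (hN : 3 ≤ N)
    (hdeg : p.natDegree ≤ N)
    (h0 : p.coeff 0 = -1)
    (hmap : p.map (PowerSeries.constantCoeff (R := ℝ)) = -1 + C 4 * X - C 5 * X ^ 2 + C 2 * X ^ 3) :
    ∃ z : (PowerSeries ℝ), p.eval z = 0 ∧ PowerSeries.constantCoeff z = 1 / 2 := by
  obtain ⟨M, rfl⟩ := Nat.exists_eq_add_of_le hN
  -- Hensel's lemma is applied to a monic polynomial, while the leading coefficient of `p` need not
  -- be a unit. Its constant coefficient is -1, so the reversal of -p is monic, and the inverse root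
  -- is sought instead. At t = 0 the reversal is X^M (X-1)^2 (X-2), with simple root 2.
  set f : (PowerSeries ℝ)[X] := (-p).reflect (3 + M) with hf
  have hfmap : f.map (PowerSeries.constantCoeff (R := ℝ)) = X ^ M * (X ^ 3 - C 4 * X ^ 2
      + C 5 * X - C 2) := by
    rw [hf, ← reflect_map, Polynomial.map_neg, hmap]
    rw [show -(-1 + C 4 * X - C 5 * X ^ 2 + C 2 * X ^ 3 : ℝ[X]) = C 1 * X ^ 0 + C (-4) * X ^ 1
      + C 5 * X ^ 2 + C (-2) * X ^ 3 by simp only [map_neg, map_one]; ring]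
    simp only [reflect_add, reflect_C_mul_X_pow]
    rw [revAt_le (by omega), revAt_le (by omega), revAt_le (by omega), revAt_le (by omega),
      show 3 + M - 0 = M + 3 by omega, show 3 + M - 1 = M + 2 by omega,
      show 3 + M - 2 = M + 1 by omega, show 3 + M - 3 = M by omega]
    simp only [map_neg, map_one]
    ring
  have hmonic : f.Monic := by
    refine monic_of_natDegree_le_of_coeff_eq_one (3 + M) ?_ ?_
    · exact natDegree_reflect_le.trans (by rw [natDegree_neg]; exact max_le le_rfl hdeg)
    · rw [hf, coeff_reflect, revAt_le le_rfl, Nat.sub_self, coeff_neg, h0, neg_neg]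
  have hI : ∀ a :
      (PowerSeries ℝ), a ∈ Ideal.span {(PowerSeries.X : PowerSeries ℝ)} ↔ PowerSeries.constantCoeff a = 0 := fun a => by
    rw [Ideal.mem_span_singleton, PowerSeries.X_dvd_iff]
  obtain ⟨l, hl, hl2⟩ := HenselianRing.is_henselian
      (I := Ideal.span {(PowerSeries.X : PowerSeries ℝ)}) f hmonic
    (PowerSeries.C 2) (by
      rw [hI, constantCoeff_eval, hfmap]
      simp
      norm_num) (by
      refine IsUnit.map _ (isUnit_of_constantCoeff_ne_zero ?_)
      rw [constantCoeff_eval, ← derivative_map, hfmap, derivative_mul]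
      simp
      norm_num)
  rw [hI] at hl2
  have hl3 : PowerSeries.constantCoeff l = 2 := by
    have : PowerSeries.constantCoeff l - 2 = 0 := by simpa using hl2
    linarith
  obtain ⟨u, rfl⟩ := isUnit_of_constantCoeff_ne_zero (f := l) (by rw [hl3]; norm_num)
  let : Invertible ((u⁻¹ : (PowerSeries ℝ)ˣ) : PowerSeries ℝ) := ⟨u, by simp, by simp⟩
  refine ⟨(u⁻¹ : (PowerSeries ℝ)ˣ), ?_, ?_⟩
  · have := (eval₂_reflect_eq_zero_iff (RingHom.id (PowerSeries ℝ)) ((u⁻¹ :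
      (PowerSeries ℝ)ˣ) : PowerSeries ℝ) (3 + M) (-p)
      (by rwa [natDegree_neg])).1 (by
        change eval₂ (RingHom.id _) (u : PowerSeries ℝ) f = 0
        rwa [eval₂_id])
    rw [eval₂_id, eval_neg, neg_eq_zero] at this
    exact this
  · have := congrArg (PowerSeries.constantCoeff (R := ℝ)) u.inv_mul
    rw [map_mul, hl3, map_one] at this
    linarith

/-- Separation of the dominant pole from a remainder of polynomial growth. -/
lemma exists_dominant_pole {F : PowerSeries (PowerSeries ℝ)} {p N : (PowerSeries ℝ)[X]} {d : ℕ}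
    (hd : 3 ≤ d) (hdeg : p.natDegree ≤ d) (h0 : p.coeff 0 = -1)
    (hmap : p.map (PowerSeries.constantCoeff (R := ℝ)) = -1 + C 4 * X - C 5 * X ^ 2 + C 2 * X ^ 3)
    (hF : F * (p : PowerSeries (PowerSeries ℝ)) = (N : PowerSeries (PowerSeries ℝ))) :
    ∃ c l : PowerSeries ℝ, PowerSeries.constantCoeff l = 2 ∧ ∀ k, ∃ (K : ℝ) (e : ℕ), ∀ n,
      |PowerSeries.coeff k (PowerSeries.coeff n F - c * l ^ n)| ≤ K * ((n : ℝ) + 1) ^ e := by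
  obtain ⟨z, hz, hz2⟩ := exists_root_of_perturbation hd hdeg h0 hmap
  obtain ⟨v, hv⟩ : (X - C z) ∣ p := by rwa [dvd_iff_isRoot]
  have hvmap : v.map (PowerSeries.constantCoeff (R := ℝ)) = C 2 * (1 - X) ^ 2 := by
    have h1 : (X - C (1 / 2) : ℝ[X]) ≠ 0 := X_sub_C_ne_zero _
    refine mul_left_cancel₀ h1 ?_
    have h2 := congrArg (Polynomial.map (PowerSeries.constantCoeff (R := ℝ))) hv
    rw [hmap, Polynomial.map_mul, Polynomial.map_sub, map_X, map_C, hz2] at h2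
    rw [← h2]
    have h3 : (C (1 / 2) * C 2 : ℝ[X]) = 1 := by rw [← C_mul]; norm_num
    have h4 : (C 4 : ℝ[X]) = 4 := rfl
    have h5 : (C 5 : ℝ[X]) = 5 := rfl
    have h6 : (C 2 : ℝ[X]) = 2 := rfl
    rw [h6] at h3
    rw [h4, h5, h6]
    linear_combination (1 - X) ^ 2 * h3
  obtain ⟨w, hw⟩ := isUnit_of_constantCoeff_ne_zero (f := v.eval z) (by
    rw [constantCoeff_eval, hvmap, hz2]
    norm_num)
  obtain ⟨u, hu⟩ := isUnit_of_constantCoeff_ne_zero (f := z) (by rw [hz2]; norm_num)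
  set c : PowerSeries ℝ := N.eval z * ((w⁻¹ : (PowerSeries ℝ)ˣ) : PowerSeries ℝ) with hc
  set l : PowerSeries ℝ := ((u⁻¹ : (PowerSeries ℝ)ˣ) : PowerSeries ℝ) with hl
  have hzl : z * l = 1 := by rw [← hu, hl, Units.mul_inv]
  obtain ⟨r, hr⟩ : (X - C z) ∣ N - C c * v := by
    rw [dvd_iff_isRoot, IsRoot.def, eval_sub, eval_mul, eval_C, hc, ← hw, mul_assoc, Units.inv_mul,
      mul_one, sub_self]
  -- The expansion of 1/(x - z), where l = 1/z. With c = N(z)/v(z) the difference F - c H has only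
  -- `v` as denominator, and `v` reduces to 2(1-x)^2 at t = 0.
  set H : PowerSeries (PowerSeries ℝ) := PowerSeries.mk fun n => -l ^ (n + 1) with hH
  have hHz : (PowerSeries.X - PowerSeries.C z) * H = 1 := by
    ext1 n
    rw [sub_mul, map_sub, PowerSeries.coeff_C_mul, hH]
    cases n with
    | zero =>
      rw [PowerSeries.coeff_mk]
      simp [hzl]
    | succ n =>
      rw [PowerSeries.coeff_succ_X_mul, PowerSeries.coeff_mk, PowerSeries.coeff_mk,
        PowerSeries.coeff_one, if_neg (by omega)]
      linear_combination l ^ (n + 1) * hzl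
  have hXz : (((X - C z : (PowerSeries ℝ)[X])) : PowerSeries (PowerSeries ℝ)) =
      PowerSeries.X - PowerSeries.C z := by
    rw [coe_sub, coe_X, coe_C]
  have hr' : (N : PowerSeries (PowerSeries ℝ)) - PowerSeries.C c * (v : PowerSeries (PowerSeries ℝ))
      = (PowerSeries.X - PowerSeries.C z) * (r : PowerSeries (PowerSeries ℝ)) := by
    rw [← hXz, ← coe_mul, ← hr, coe_sub, coe_mul, coe_C]
  have hv' : (p : PowerSeries (PowerSeries ℝ)) =
      (PowerSeries.X - PowerSeries.C z) * (v : PowerSeries (PowerSeries ℝ)) := by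
    rw [← hXz, ← coe_mul, ← hv]
  have hE : (F - PowerSeries.C c * H) * (v : PowerSeries (PowerSeries ℝ)) =
      (r : PowerSeries (PowerSeries ℝ)) := by
    rw [hv'] at hF
    linear_combination H * hF + H * hr' - (F * (v : PowerSeries (PowerSeries ℝ))
      - (r : PowerSeries (PowerSeries ℝ))) * hHz
  have hgrow := coeff_mem_polyGrowth_of_mul_eq (E := swapHom (F - PowerSeries.C c * H))
    (V := swapHom (v : PowerSeries (PowerSeries ℝ))) (r := swapHom (r : PowerSeries
        (PowerSeries ℝ)))
    (by rw [← map_mul, hE]) (by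
      have h1 : PowerSeries.coeff 0 (swapHom (v : PowerSeries (PowerSeries ℝ))) =
          ((v.map (PowerSeries.constantCoeff (R := ℝ)) : ℝ[X]) : PowerSeries ℝ) := by
        ext n
        rw [coeff_coeff_swapHom, coeff_coe, coeff_coe, coeff_map,
          PowerSeries.coeff_zero_eq_constantCoeff]
      rw [h1, hvmap]
      simp) (coeff_swapHom_coe_mem_polyGrowth v) (coeff_swapHom_coe_mem_polyGrowth r)
  refine ⟨-(c * l), l, ?_, fun k => ?_⟩
  · have := congrArg (PowerSeries.constantCoeff (R := ℝ)) hzl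
    rw [map_mul, hz2, map_one] at this
    linarith
  · obtain ⟨K, e, h⟩ := hgrow k
    refine ⟨K, e, fun n => ?_⟩
    have h := h n
    rw [coeff_coeff_swapHom, map_sub, PowerSeries.coeff_C_mul, hH, PowerSeries.coeff_mk] at h
    rwa [show -(c * l) * l ^ n = c * -l ^ (n + 1) by ring]

/-- Constant terms 1 mean that the weights are trivial at t = 0, where the denominator is the one
that counts all compositions. -/
lemma exists_decomposition {P Q : PowerSeries ℝ} (hP : PowerSeries.constantCoeff P = 1)
    (hQ : PowerSeries.constantCoeff Q = 1) :
    ∃ c l : PowerSeries ℝ, PowerSeries.constantCoeff l = 2 ∧ ∀ k, ∃ (K : ℝ) (e : ℕ), ∀ n,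
      |PowerSeries.coeff k (PowerSeries.coeff n (weightSeries P Q) - c * l ^ n)|
        ≤ K * ((n : ℝ) + 1) ^ e := by
  refine exists_dominant_pole (p := denom X (C P) (C Q)) (N := numer X (C P) (C Q)) (d := 18)
    (by norm_num) ?_ ?_ ?_ ?_
  · unfold denom
    compute_degree
  · rw [coeff_zero_eq_eval_zero, ← coe_evalRingHom, map_denom, coe_evalRingHom]
    simp [denom]
  · rw [← coe_mapRingHom, map_denom, coe_mapRingHom, map_X, map_C, map_C, hP, hQ]
    simp only [denom, map_one, map_ofNat]
    ring
  · rw [← coeToPowerSeries.ringHom_apply, ← coeToPowerSeries.ringHom_apply, map_denom, map_numer,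
      coeToPowerSeries.ringHom_apply, coeToPowerSeries.ringHom_apply,
      coeToPowerSeries.ringHom_apply, coe_X, coe_C, coe_C]
    exact weightSeries_mul_denom P Q

end Pole

/-! ### Coefficientwise limits -/

section Limits

open PowerSeries

/-- Coefficientwise convergence of power series. -/
def CoeffTendsto (f : ℕ → PowerSeries ℝ) (g : PowerSeries ℝ) : Prop :=
  ∀ k, Tendsto (fun n => coeff k (f n)) atTop (𝓝 (coeff k g))

lemma CoeffTendsto.mul {f₁ f₂ : ℕ → PowerSeries ℝ} {g₁ g₂ : PowerSeries ℝ}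
    (h₁ : CoeffTendsto f₁ g₁) (h₂ : CoeffTendsto f₂ g₂) :
    CoeffTendsto (fun n => f₁ n * f₂ n) (g₁ * g₂) := fun k => by
  simp only [coeff_mul]
  exact tendsto_finsetSum _ fun p _ => (h₁ p.1).mul (h₂ p.2)

lemma CoeffTendsto.add {f₁ f₂ : ℕ → PowerSeries ℝ} {g₁ g₂ : PowerSeries ℝ}
    (h₁ : CoeffTendsto f₁ g₁) (h₂ : CoeffTendsto f₂ g₂) :
    CoeffTendsto (fun n => f₁ n + f₂ n) (g₁ + g₂) := fun k => by
  simp only [map_add]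
  exact (h₁ k).add (h₂ k)

/-- The series `exp (x X)`. -/
noncomputable def expSeries (x : ℝ) : PowerSeries ℝ := rescale x (PowerSeries.exp ℝ)

lemma coeff_expSeries (x : ℝ) (k : ℕ) : coeff k (expSeries x) = x ^ k / k.factorial := by
  rw [expSeries, coeff_rescale, coeff_exp]
  simp [div_eq_mul_inv]

lemma constantCoeff_expSeries (x : ℝ) : constantCoeff (expSeries x) = 1 := by
  rw [← coeff_zero_eq_constantCoeff_apply, coeff_expSeries]
  simp

lemma expSeries_add (x y : ℝ) : expSeries (x + y) = expSeries x * expSeries y :=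
  (exp_mul_exp_eq_exp_add x y).symm

lemma expSeries_pow (x : ℝ) (n : ℕ) : expSeries x ^ n = expSeries (n * x) := by
  induction n with
  | zero =>
    ext k
    rw [pow_zero, coeff_expSeries, coeff_one]
    cases k <;> simp
  | succ n ih => rw [pow_succ, ih, ← expSeries_add]; congr 1; push_cast; ring

/-- The series `exp (σ X ^ 2)`. -/
noncomputable def gaussSeries (σ : ℝ) : PowerSeries ℝ :=
  PowerSeries.mk fun k => if Even k then σ ^ (k / 2) / (k / 2).factorial else 0

lemma tendsto_inv_sqrt : Tendsto (fun n : ℕ => (√(n : ℝ))⁻¹) atTop (𝓝 0) :=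
  (Real.tendsto_sqrt_atTop.comp tendsto_natCast_atTop_atTop).inv_tendsto_atTop

lemma tendsto_choose_div_pow (m : ℕ) :
    Tendsto (fun n : ℕ => (n.choose m : ℝ) / n ^ m) atTop (𝓝 (1 / m.factorial)) := by
  have hm : (m.factorial : ℝ) ≠ 0 := by positivity
  have h := (isEquivalent_iff_tendsto_one (by
    filter_upwards [eventually_gt_atTop 0] with n hn
    positivity)).1 (isEquivalent_choose m)
  refine (h.div_const (m.factorial : ℝ)).congr fun n => ?_
  rw [Pi.div_apply]
  field_simp

lemma coeff_one_add_X_sq_mul_pow (η : PowerSeries ℝ) (n k : ℕ) :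
    coeff k ((1 + X ^ 2 * η) ^ n) = ∑ m ∈ Finset.range (k + 1),
      (n.choose m : ℝ) * if 2 * m ≤ k then coeff (k - 2 * m) (η ^ m) else 0 := by
  have hterm : ∀ m, coeff k ((X ^ 2 * η) ^ m * (n.choose m : PowerSeries ℝ)) =
      (n.choose m : ℝ) * if 2 * m ≤ k then coeff (k - 2 * m) (η ^ m) else 0 := by
    intro m
    rw [mul_pow, ← pow_mul, ← map_natCast (C (R := ℝ)), coeff_mul_C, coeff_X_pow_mul', mul_comm]
  rw [add_comm, add_pow, map_sum]
  simp only [one_pow, mul_one, hterm]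
  refine (Finset.sum_subset (Finset.range_mono (show n + 1 ≤ n + k + 1 by omega)) ?_).trans
    (Finset.sum_subset (Finset.range_mono (show k + 1 ≤ n + k + 1 by omega)) ?_).symm
  · intro m _ hm
    rw [Nat.choose_eq_zero_of_lt (by simp at hm; omega)]
    simp
  · intro m _ hm
    rw [if_neg (by simp at hm; omega), mul_zero]

/-- Write ν = 1 + X² η. In the binomial expansion of ν^n the m-th term, scaled by n^(-k/2), is (n
choose m)/n^m times n^(-(k-2m)/2): only k = 2m survives and leaves η(0)^m/m!. In the limit this
selection is made by the factor 0^(k-2m). -/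
lemma CoeffTendsto.rescale_pow {ν : PowerSeries ℝ} (h0 : coeff 0 ν = 1) (h1 : coeff 1 ν = 0) :
    CoeffTendsto (fun n : ℕ => rescale (√(n : ℝ))⁻¹ (ν ^ n)) (gaussSeries (coeff 2 ν)) := by
  obtain ⟨η, hη⟩ : ∃ η, ν = 1 + X ^ 2 * η := by
    have : X ^ 2 ∣ ν - 1 := by
      rw [X_pow_dvd_iff]
      intro m hm
      interval_cases m
      · simp at h0
        simp [h0]
      · simp [h1, coeff_one]
    obtain ⟨η, h⟩ := this
    exact ⟨η, by rw [← h]; ring⟩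
  have h2 : coeff 2 ν = coeff 0 η := by
    rw [hη, map_add, coeff_X_pow_mul', coeff_one]
    simp
  intro k
  rw [h2]
  have hlim : coeff k (gaussSeries (coeff 0 η)) = ∑ m ∈ Finset.range (k + 1),
      (1 / (m.factorial : ℝ)) * (0 ^ (k - 2 * m) *
        if 2 * m ≤ k then coeff (k - 2 * m) (η ^ m) else 0) := by
    simp only [gaussSeries, coeff_mk]
    by_cases hk : Even k
    · obtain ⟨j, rfl⟩ := hk
      rw [if_pos ⟨j, rfl⟩, Finset.sum_eq_single j]
      · rw [show j + j - 2 * j = 0 by omega, show (j + j) / 2 = j by omega, if_pos (by omega)]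
        simp [div_eq_inv_mul]
      · intro m _ hm
        split_ifs with h
        · rw [zero_pow (by omega)]
          ring
        · ring
      · intro h
        exact absurd (Finset.mem_range.2 (by omega)) h
    · rw [if_neg hk]
      symm
      refine Finset.sum_eq_zero fun m _ => ?_
      split_ifs with h
      · have : k ≠ 2 * m := fun e => hk ⟨m, by omega⟩
        rw [zero_pow (by omega)]
        ring
      · ring
  rw [hlim]
  have hev : ∀ᶠ n : ℕ in atTop, coeff k (rescale (√(n : ℝ))⁻¹ (ν ^ n)) =
      ∑ m ∈ Finset.range (k + 1), ((n.choose m : ℝ) / n ^ m) * ((√(n : ℝ))⁻¹ ^ (k - 2 * m) *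
        if 2 * m ≤ k then coeff (k - 2 * m) (η ^ m) else 0) := by
    filter_upwards [eventually_gt_atTop 0] with n hn
    rw [coeff_rescale, hη, coeff_one_add_X_sq_mul_pow, Finset.mul_sum]
    refine Finset.sum_congr rfl fun m _ => ?_
    split_ifs with h
    · have hn' : (0 : ℝ) < n := by positivity
      have hs : √(n : ℝ) ^ (2 * m) = n ^ m := by rw [pow_mul, Real.sq_sqrt hn'.le]
      have hp : 0 < √(n : ℝ) := Real.sqrt_pos.2 hn'
      have e : (√(n : ℝ))⁻¹ ^ k = (√(n : ℝ))⁻¹ ^ (k - 2 * m) * (n ^ m : ℝ)⁻¹ := by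
        rw [← hs, ← inv_pow, ← pow_add, Nat.sub_add_cancel h]
      rw [e]
      field_simp
    · simp
  refine Tendsto.congr' (hev.mono fun n h => h.symm) (tendsto_finsetSum _ fun m _ => ?_)
  exact (tendsto_choose_div_pow m).mul ((tendsto_inv_sqrt.pow _).mul_const _)

lemma tendsto_of_abs_le_poly_div_two_pow {u : ℕ → ℝ} {K : ℝ} {e : ℕ}
    (h : ∀ᶠ n : ℕ in atTop, |u n| ≤ K * ((n : ℝ) + 1) ^ e / 2 ^ n) (d : ℕ) :
    Tendsto (fun n : ℕ => (n : ℝ) ^ d * u n) atTop (𝓝 0) := by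
  have h1 : Tendsto (fun n : ℕ => (n : ℝ) ^ (e + d) / 2 ^ n) atTop (𝓝 0) :=
    tendsto_pow_const_div_const_pow_of_one_lt _ (by norm_num)
  have h2 := (((tendsto_add_atTop_iff_nat 1).2 h1).const_mul (2 * K))
  rw [mul_zero] at h2
  refine squeeze_zero_norm' ?_ h2
  filter_upwards [h] with n hn
  rw [Real.norm_eq_abs, abs_mul, abs_of_nonneg (by positivity : (0 : ℝ) ≤ (n : ℝ) ^ d)]
  have hK : 0 ≤ K * ((n : ℝ) + 1) ^ e / 2 ^ n := (abs_nonneg _).trans hn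
  calc (n : ℝ) ^ d * |u n| ≤ ((n : ℝ) + 1) ^ d * (K * ((n : ℝ) + 1) ^ e / 2 ^ n) := by
        gcongr
        linarith
    _ = 2 * K * (((n + 1 : ℕ) : ℝ) ^ (e + d) / 2 ^ (n + 1)) := by
        push_cast
        rw [pow_add, pow_succ (2 : ℝ)]
        field_simp

lemma coeff_one_pow_of_constantCoeff {μ : PowerSeries ℝ} (h : constantCoeff μ = 1) (n : ℕ) :
    constantCoeff (μ ^ n) = 1 ∧ coeff 1 (μ ^ n) = n * coeff 1 μ := by
  have h0 : ∀ n, constantCoeff (μ ^ n) = 1 := fun n => by rw [map_pow, h, one_pow]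
  refine ⟨h0 n, ?_⟩
  induction n with
  | zero => simp [coeff_one]
  | succ n ih =>
    rw [pow_succ, coeff_one_mul, ih, h0, h]
    push_cast
    ring

/-- Quasi-powers: centred at the mean and rescaled, the moments become Gaussian. -/
theorem coeffTendsto_of_quasiPower {M : ℕ → PowerSeries ℝ} {A μ : PowerSeries ℝ}
    (hμ : constantCoeff μ = 1) (hM : ∀ n, constantCoeff (M n) = 1)
    (hε : ∀ k, ∃ (K : ℝ) (e : ℕ), ∀ᶠ n : ℕ in atTop,
      |coeff k (M n - A * μ ^ n)| ≤ K * ((n : ℝ) + 1) ^ e / 2 ^ n) :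
    ∃ σ, CoeffTendsto
      (fun n : ℕ => rescale (√(n : ℝ))⁻¹ (expSeries (-coeff 1 (M n)) * M n)) (gaussSeries σ) := by
  have hsmall : ∀ k d, Tendsto (fun n : ℕ => (n : ℝ) ^ d * coeff k (M n - A * μ ^ n)) atTop (𝓝 0) :=
    fun k d => by
      obtain ⟨K, e, h⟩ := hε k
      exact tendsto_of_abs_le_poly_div_two_pow h d
  -- The order-zero error is the constant 1 - A(0), and it tends to 0.
  have hA : constantCoeff A = 1 := by
    have h := hsmall 0 0
    have e : ∀ n : ℕ, (n : ℝ) ^ 0 * coeff 0 (M n - A * μ ^ n) = 1 - constantCoeff A := fun n => by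
      rw [coeff_zero_eq_constantCoeff_apply, map_sub, map_mul, hM,
        (coeff_one_pow_of_constantCoeff hμ n).1]
      ring
    simp only [e] at h
    linarith [tendsto_nhds_unique h tendsto_const_nhds]
  set β := coeff 1 μ with hβ
  set ν := expSeries (-β) * μ with hν
  have hν0 : coeff 0 ν = 1 := by
    rw [coeff_zero_eq_constantCoeff_apply, hν, map_mul, constantCoeff_expSeries, hμ, one_mul]
  have hν1 : coeff 1 ν = 0 := by
    rw [hν, coeff_one_mul, constantCoeff_expSeries, hμ, coeff_expSeries]
    simp [hβ]
  -- Centring at the exact mean instead of n β shifts by a bounded amount, which vanishes on the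
  -- scale √n.
  have hδ : Tendsto (fun n : ℕ => coeff 1 (M n) - n * β) atTop (𝓝 (coeff 1 A)) := by
    have h := (hsmall 1 0).add_const (coeff 1 A)
    rw [zero_add] at h
    refine h.congr fun n => ?_
    rw [map_sub, coeff_one_mul, hA, (coeff_one_pow_of_constantCoeff hμ n).1,
      (coeff_one_pow_of_constantCoeff hμ n).2]
    ring
  have h1 : CoeffTendsto (fun n : ℕ => rescale (√(n : ℝ))⁻¹ (expSeries (-(coeff 1 (M n) - n * β))))
      1 := fun k => by
    have h := ((tendsto_inv_sqrt.mul hδ.neg).pow k).div_const (k.factorial : ℝ)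
    rw [zero_mul] at h
    have e : coeff k (1 : PowerSeries ℝ) = 0 ^ k / (k.factorial : ℝ) := by
      rw [coeff_one]
      split_ifs with hk
      · simp [hk]
      · simp [hk]
    rw [e]
    refine h.congr fun n => ?_
    rw [coeff_rescale, coeff_expSeries, mul_pow]
    ring
  have h2 : CoeffTendsto (fun n : ℕ => rescale (√(n : ℝ))⁻¹ A) 1 := fun k => by
    have h := (tendsto_inv_sqrt.pow k).mul_const (coeff k A)
    have e : coeff k (1 : PowerSeries ℝ) = 0 ^ k * coeff k A := by
      rw [coeff_one]
      split_ifs with hk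
      · simp [hk, hA]
      · simp [hk]
    rw [e]
    refine h.congr fun n => ?_
    rw [coeff_rescale]
  have h3 := CoeffTendsto.rescale_pow hν0 hν1
  have h4 : CoeffTendsto (fun n : ℕ => rescale (√(n : ℝ))⁻¹
      (expSeries (-(n * β)) * (M n - A * μ ^ n))) 0 := fun k => by
    have h : Tendsto (fun n : ℕ => coeff k (expSeries (-(n * β)) * (M n - A * μ ^ n))) atTop
        (𝓝 0) := by
      simp only [coeff_mul]
      rw [← Finset.sum_const_zero (s := Finset.HasAntidiagonal.antidiagonal k)]
      refine tendsto_finsetSum _ fun p _ => ?_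
      -- The centring factor contributes a power of n, which the exponentially small remainder
      -- absorbs.
      have h := (hsmall p.2 p.1).const_mul ((-β) ^ p.1 / (p.1.factorial : ℝ))
      rw [mul_zero] at h
      refine h.congr fun n => ?_
      rw [coeff_expSeries, show -((n : ℝ) * β) = -β * n by ring, mul_pow]
      ring
    have h' := (tendsto_inv_sqrt.pow k).mul h
    rw [mul_zero] at h'
    simpa only [coeff_rescale, map_zero] using h'
  refine ⟨coeff 2 ν, ?_⟩
  have h5 := h1.mul ((h2.mul h3).add h4)
  rw [one_mul, add_zero, one_mul] at h5
  refine fun k => (h5 k).congr fun n => ?_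
  dsimp only
  rw [← map_mul, ← map_add, ← map_mul]
  congr 2
  have e1 : expSeries (-coeff 1 (M n)) =
      expSeries (-(coeff 1 (M n) - n * β)) * expSeries (-(n * β)) := by
    rw [← expSeries_add]
    congr 1
    ring
  have e2 : ν ^ n = expSeries (-(n * β)) * μ ^ n := by
    rw [hν, mul_pow, expSeries_pow]
    congr 2
    ring
  rw [e1, e2]
  ring

end Limits

/-! ### Moments of linear combinations of the two statistics -/

section Linear

open PowerSeries

/-- A linear combination of the numbers of occurrences of the two patterns. -/
def linOcc (a b : ℝ) (n : ℕ) (c : Composition n) : ℝ :=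
  a * occ [2, 3, 4] n c + b * occ [4, 3, 2] n c

/-- The formal moment generating function of `linOcc`. -/
noncomputable def momentSeries (a b : ℝ) (n : ℕ) : PowerSeries ℝ :=
  C (Fintype.card (Composition n) : ℝ)⁻¹ * ∑ c, expSeries (linOcc a b n c)

lemma coeff_momentSeries (a b x : ℝ) (n k : ℕ) : coeff k (expSeries x * momentSeries a b n) =
    mean n (fun c => (x + linOcc a b n c) ^ k) / k.factorial := by
  rw [momentSeries, mul_left_comm, coeff_C_mul, Finset.mul_sum, map_sum]
  simp only [← expSeries_add, coeff_expSeries, mean, ← Finset.sum_div]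
  field_simp

lemma momentSeries_eq (a b : ℝ) {n : ℕ} (hn : 0 < n) : momentSeries a b n =
    C (2 / 2 ^ n) * coeff n (weightSeries (expSeries a) (expSeries b)) := by
  have e : ((Fintype.card (Composition n) : ℝ))⁻¹ = 2 / 2 ^ n := by
    rw [composition_card]
    obtain ⟨m, rfl⟩ := Nat.exists_eq_succ_of_ne_zero hn.ne'
    rw [Nat.succ_eq_add_one, Nat.add_sub_cancel]
    push_cast
    rw [pow_succ]
    field_simp
  rw [momentSeries, e, weightSeries, coeff_mk]
  congr 1
  refine Finset.sum_congr rfl fun c _ => ?_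
  rw [expSeries_pow, expSeries_pow, ← expSeries_add, linOcc, occ, occ]
  congr 1
  ring

/-- The centred moments of linear combinations are asymptotically Gaussian. -/
theorem exists_tendsto_centred_moments (a b : ℝ) : ∃ σ : ℝ, ∀ k : ℕ, Tendsto
    (fun n : ℕ => mean n (fun c => (linOcc a b n c - mean n (linOcc a b n)) ^ k) / √(n : ℝ) ^ k)
    atTop (𝓝 (k.factorial * coeff k (gaussSeries σ))) := by
  obtain ⟨c, l, hl, h⟩ := exists_decomposition (constantCoeff_expSeries a)
      (constantCoeff_expSeries b)
  have hone : ∀ n, momentSeries a b n = expSeries 0 * momentSeries a b n := fun n => by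
    have : expSeries 0 = 1 := by simpa using (expSeries_pow 1 0).symm
    rw [this, one_mul]
  obtain ⟨σ, hσ⟩ := coeffTendsto_of_quasiPower (M := momentSeries a b) (A := C 2 * c)
    (μ := C (1 / 2) * l) (by rw [map_mul, hl]; norm_num)
    (fun n => by
      rw [← coeff_zero_eq_constantCoeff_apply, hone, coeff_momentSeries]
      simp [mean_const])
    (fun k => by
      obtain ⟨K, e, h⟩ := h k
      refine ⟨2 * K, e, ?_⟩
      filter_upwards [eventually_gt_atTop 0] with n hn
      have e1 : momentSeries a b n - C 2 * c * (C (1 / 2) * l) ^ n =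
          C (2 / 2 ^ n) * (coeff n (weightSeries (expSeries a) (expSeries b)) - c * l ^ n) := by
        rw [momentSeries_eq a b hn, mul_pow, ← map_pow, mul_sub,
          show (2 / 2 ^ n : ℝ) = 2 * (1 / 2) ^ n by rw [one_div, inv_pow]; rfl, map_mul]
        ring
      rw [e1, coeff_C_mul, abs_mul, abs_of_pos (by positivity)]
      calc _ ≤ 2 / 2 ^ n * (K * ((n : ℝ) + 1) ^ e) :=
            mul_le_mul_of_nonneg_left (h n) (by positivity)
        _ = _ := by ring)
  refine ⟨σ, fun k => ?_⟩
  have h1 := (hσ k).const_mul (k.factorial : ℝ)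
  refine h1.congr fun n => ?_
  have hm : coeff 1 (momentSeries a b n) = mean n (linOcc a b n) := by
    rw [hone, coeff_momentSeries]
    simp
  have hk : (k.factorial : ℝ) ≠ 0 := by positivity
  rw [coeff_rescale, coeff_momentSeries, hm, inv_pow]
  simp only [neg_add_eq_sub]
  field_simp

end Linear

/-! ### Moments of the bivariate normal law -/

section Gauss

lemma hasDerivAt_mul_sq_div_two (v t : ℝ) : HasDerivAt (fun t : ℝ => v * t ^ 2 / 2) (v * t) t :=
  (((hasDerivAt_pow 2 t).const_mul v).div_const 2).congr_deriv (by push_cast; ring)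

/-- Repeated differentiation of f' = v t f. At t = 0 it becomes a two-step recursion, which the
coefficients of `gaussSeries (v / 2)` satisfy as well. -/
lemma iteratedDeriv_exp_sq (v : ℝ) (k : ℕ) (t : ℝ) :
    iteratedDeriv (k + 2) (fun t => Real.exp (v * t ^ 2 / 2)) t =
      v * (t * iteratedDeriv (k + 1) (fun t => Real.exp (v * t ^ 2 / 2)) t
        + (k + 1) * iteratedDeriv k (fun t => Real.exp (v * t ^ 2 / 2)) t) := by
  set f : ℝ → ℝ := fun t => Real.exp (v * t ^ 2 / 2) with hf
  have hs : ContDiff ℝ ⊤ f := by fun_prop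
  have hd : ∀ k, Differentiable ℝ (iteratedDeriv k f) := fun k =>
    hs.differentiable_iteratedDeriv k (by exact_mod_cast WithTop.coe_lt_top _)
  have h1 : deriv f = fun t => v * (t * f t) := by
    funext t
    rw [hf, (hasDerivAt_mul_sq_div_two v t).exp.deriv]
    ring
  induction k generalizing t with
  | zero =>
    rw [zero_add, iteratedDeriv_succ, iteratedDeriv_one, h1]
    have h := (((hasDerivAt_id t).mul (hd 0 t).hasDerivAt).const_mul v).deriv
    rw [iteratedDeriv_zero, h1] at h
    rw [iteratedDeriv_zero, Nat.cast_zero]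
    refine h.trans ?_
    simp only [id]
    ring
  | succ k ih =>
    rw [iteratedDeriv_succ, funext ih]
    have h := ((((hasDerivAt_id t).mul (hd (k + 1) t).hasDerivAt).add
      ((hd k t).hasDerivAt.const_mul ((k : ℝ) + 1))).const_mul v).deriv
    refine h.trans ?_
    rw [← iteratedDeriv_succ, ← iteratedDeriv_succ, ih]
    simp only [id]
    push_cast
    ring

lemma factorial_mul_coeff_gaussSeries (v : ℝ) (k : ℕ) :
    ((k + 2).factorial : ℝ) * PowerSeries.coeff (k + 2) (gaussSeries (v / 2)) =
      v * ((k + 1) * (k.factorial * PowerSeries.coeff k (gaussSeries (v / 2)))) := by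
  simp only [gaussSeries, PowerSeries.coeff_mk]
  have e : Even (k + 2) ↔ Even k := by simp [Nat.even_add]
  simp only [e]
  split_ifs with h
  · obtain ⟨m, rfl⟩ := h
    rw [show (m + m + 2) / 2 = m + 1 by omega, show (m + m) / 2 = m by omega,
      Nat.factorial_succ, Nat.factorial_succ, Nat.factorial_succ m]
    have := Nat.factorial_ne_zero m
    push_cast
    field_simp
    ring
  · simp

lemma iteratedDeriv_exp_sq_zero (v : ℝ) (k : ℕ) :
    iteratedDeriv k (fun t => Real.exp (v * t ^ 2 / 2)) 0 =
      k.factorial * PowerSeries.coeff k (gaussSeries (v / 2)) := by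
  induction k using Nat.twoStepInduction with
  | zero => simp [gaussSeries]
  | one =>
    rw [iteratedDeriv_one, (hasDerivAt_mul_sq_div_two v 0).exp.deriv]
    simp [gaussSeries]
  | more k ih _ => rw [iteratedDeriv_exp_sq, ih, factorial_mul_coeff_gaussSeries, zero_mul, zero_add]

lemma integral_pow_gaussianReal (v : NNReal) (k : ℕ) :
    ∫ x, x ^ k ∂gaussianReal 0 v = k.factorial * PowerSeries.coeff k (gaussSeries (v / 2)) := by
  have h := iteratedDeriv_mgf_zero (X := id) (μ := gaussianReal 0 v)
    (by rw [integrableExpSet_id_gaussianReal]; simp) k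
  rw [mgf_id_gaussianReal] at h
  simp only [zero_mul, zero_add] at h
  rw [← iteratedDeriv_exp_sq_zero, h]
  simp

variable {ρ : ℝ}

/-- The quadratic form is (x₀ + ρ x₁)² + (1 - ρ²) x₁². -/
lemma posSemidef_of_sq_le_one (hρ : ρ ^ 2 ≤ 1) : (!![1, ρ; ρ, 1] : Matrix (Fin 2)
    (Fin 2) ℝ).PosSemidef := by
  refine Matrix.PosSemidef.of_dotProduct_mulVec_nonneg ?_ fun x => ?_
  · ext i j
    fin_cases i <;> fin_cases j <;> simp
  · simp [Matrix.mulVec, dotProduct, Fin.sum_univ_two]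
    nlinarith [sq_nonneg (x 0 + ρ * x 1), mul_nonneg (sub_nonneg.2 hρ) (sq_nonneg (x 1))]

instance : IsGaussian (bivariateNormal ρ) := by
  unfold bivariateNormal
  infer_instance

lemma memLp_coord (i : Fin 2) {p : ENNReal} (hp : p ≠ ⊤) :
    MemLp (fun x : EuclideanSpace ℝ (Fin 2) => x i) p (bivariateNormal ρ) := by
  have h := (IsGaussian.memLp_id (bivariateNormal ρ) p hp).continuousLinearMap_comp
    (EuclideanSpace.proj (𝕜 := ℝ) i)
  exact h

/-- Coordinates lie in every L^p with p finite, so each power lies in L², and Hölder's inequality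
handles the product. -/
lemma integrable_coord_pow_mul_pow (i j : ℕ) :
    Integrable (fun p => p 0 ^ i * p 1 ^ j) (bivariateNormal ρ) := by
  have h : ∀ (l : Fin 2) (i : ℕ), MemLp (fun p : EuclideanSpace ℝ (Fin 2) => p l ^ i) 2
      (bivariateNormal ρ) := by
    intro l i
    rcases Nat.eq_zero_or_pos i with rfl | hi
    · simpa using memLp_const (μ := bivariateNormal ρ) (p := 2) (1 : ℝ)
    · have h := (memLp_coord (ρ := ρ) l (p := 2 * i) (by finiteness)).norm_rpow_div i
      have hi' : (i : ENNReal) ≠ 0 := by exact_mod_cast hi.ne'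
      rw [ENNReal.mul_div_cancel_right hi' (by finiteness)] at h
      refine (memLp_norm_iff ?_).1 (h.congr_norm ?_ ?_)
      · fun_prop
      · fun_prop
      · simp
  exact (h 0 i).integrable_mul (h 1 j)

lemma map_bivariateNormal (hρ : ρ ^ 2 ≤ 1) (b : ℝ) :
    (bivariateNormal ρ).map (fun p => p 0 + b * p 1) =
      gaussianReal 0 (1 + 2 * ρ * b + b ^ 2).toNNReal := by
  have h := IsGaussian.map_eq_gaussianReal (μ := bivariateNormal ρ)
    (EuclideanSpace.proj (𝕜 := ℝ) (0 : Fin 2) + b • EuclideanSpace.proj (𝕜 := ℝ) (1 : Fin 2))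
  have e : (⇑(EuclideanSpace.proj (𝕜 := ℝ) (0 : Fin 2) + b • EuclideanSpace.proj (𝕜 := ℝ)
      (1 : Fin 2)) :
      EuclideanSpace ℝ (Fin 2) → ℝ) = fun p => p 0 + b * p 1 := by
    funext p
    simp
  have hm : (bivariateNormal ρ)[fun p : EuclideanSpace ℝ (Fin 2) => p 0 + b * p 1] = 0 := by
    rw [← e, IsGaussian.integral_dual]
    simp [bivariateNormal]
  have hv : Var[fun p : EuclideanSpace ℝ (Fin 2) => p 0 + b * p 1; bivariateNormal ρ] =
      1 + 2 * ρ * b + b ^ 2 := by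
    have hS := posSemidef_of_sq_le_one hρ
    rw [variance_fun_add (memLp_coord 0 (by simp)) ((memLp_coord 1 (by simp)).const_mul b),
      variance_const_mul, covariance_const_mul_right, bivariateNormal,
      variance_eval_multivariateGaussian hS, variance_eval_multivariateGaussian hS,
      covariance_eval_multivariateGaussian hS]
    simp
    ring
  rw [e, hm, hv] at h
  exact h

lemma integral_add_mul_pow (hρ : ρ ^ 2 ≤ 1) (b : ℝ) (k : ℕ) :
    ∫ p, (p 0 + b * p 1) ^ k ∂bivariateNormal ρ =
      k.factorial * PowerSeries.coeff k (gaussSeries ((1 + 2 * ρ * b + b ^ 2) / 2)) := by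
  have h := integral_pow_gaussianReal (1 + 2 * ρ * b + b ^ 2).toNNReal k
  rw [← map_bivariateNormal hρ, integral_map (by fun_prop) (by fun_prop), Real.coe_toNNReal] at h
  · exact h
  · nlinarith [sq_nonneg (ρ + b)]

end Gauss

/-! ### Separating the coefficients of a polynomial -/

/-- Pointwise convergence of polynomials of bounded degree implies convergence of the
coefficients. -/
lemma tendsto_coeff_of_tendsto_eval {m : ℕ} {u : ℕ → ℕ → ℝ} {w : ℕ → ℝ}
    (h : ∀ b : ℝ, Tendsto (fun n => ∑ j ∈ Finset.range m, u j n * b ^ j) atTop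
      (𝓝 (∑ j ∈ Finset.range m, w j * b ^ j))) {j : ℕ} (hj : j < m) :
    Tendsto (u j) atTop (𝓝 (w j)) := by
  -- Evaluating at the nodes 0, …, m-1 determines the coefficients through a fixed invertible
  -- matrix, so each coefficient is a finite linear combination of convergent values.
  set V : Matrix (Fin m) (Fin m) ℝ := Matrix.vandermonde fun i => ((i : ℕ) : ℝ) with hV
  have hdet : IsUnit V.det := by
    rw [isUnit_iff_ne_zero, Ne, Matrix.det_vandermonde_eq_zero_iff]
    rintro ⟨i, j, hij, hne⟩
    exact hne (Fin.ext (by exact_mod_cast hij))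
  have hmul : ∀ x : Fin m → ℝ, V⁻¹.mulVec (V.mulVec x) = x := fun x => by
    rw [Matrix.mulVec_mulVec, Matrix.nonsing_inv_mul V hdet, Matrix.one_mulVec]
  have hmv : ∀ (x : ℕ → ℝ) (i : Fin m), V.mulVec (fun j => x j) i =
      ∑ j ∈ Finset.range m, x j * ((i : ℕ) : ℝ) ^ j := fun x i => by
    rw [Finset.sum_range, Matrix.mulVec, dotProduct]
    exact Finset.sum_congr rfl fun l _ => by rw [hV, Matrix.vandermonde_apply, mul_comm]
  have key : ∀ x : ℕ → ℝ, x j = ∑ i : Fin m, V⁻¹ ⟨j, hj⟩ i *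
      ∑ l ∈ Finset.range m, x l * ((i : ℕ) : ℝ) ^ l := fun x => by
    simp_rw [← hmv]
    exact (congrFun (hmul fun l => x l) ⟨j, hj⟩).symm
  rw [key w]
  refine (tendsto_finsetSum Finset.univ fun (i : Fin m) _ =>
    (h ((i : ℕ) : ℝ)).const_mul (V⁻¹ ⟨j, hj⟩ i)).congr fun n => ?_
  exact (key fun l => u l n).symm

/-! ### Joint asymptotic normality -/

section Joint

lemma mean_linOcc (b : ℝ) (n : ℕ) :
    mean n (linOcc 1 b n) = mean n (occ [2, 3, 4] n) + b * mean n (occ [4, 3, 2] n) := by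
  rw [← mean_const_mul, ← mean_add]
  congr 1
  funext c
  rw [linOcc, one_mul]

lemma var_linOcc (b : ℝ) (n : ℕ) : var n (linOcc 1 b n) = var n (occ [2, 3, 4] n)
    + b ^ 2 * var n (occ [4, 3, 2] n) + 2 * b * cov n (occ [2, 3, 4] n) (occ [4, 3, 2] n) := by
  rw [var, mean_linOcc]
  have e : (fun c => (linOcc 1 b n c - (mean n (occ [2, 3, 4] n) + b * mean n
      (occ [4, 3, 2] n))) ^ 2)
      = fun c => ((occ [2, 3, 4] n c - mean n (occ [2, 3, 4] n)) ^ 2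
        + b ^ 2 * (occ [4, 3, 2] n c - mean n (occ [4, 3, 2] n)) ^ 2)
        + 2 * b * ((occ [2, 3, 4] n c - mean n (occ [2, 3, 4] n))
          * (occ [4, 3, 2] n c - mean n (occ [4, 3, 2] n))) := by
    funext c
    rw [linOcc]
    ring
  rw [e, mean_add, mean_add, mean_const_mul, mean_const_mul]
  rfl

lemma tendsto_centred_moments (b : ℝ) (k : ℕ) : Tendsto
    (fun n : ℕ => mean n (fun c => (linOcc 1 b n c - mean n (linOcc 1 b n)) ^ k) / √(n : ℝ) ^ k)
    atTop (𝓝 (k.factorial * PowerSeries.coeff k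
      (gaussSeries (147 / 16384 * ((1 + 2 * (71 / 147) * b + b ^ 2) / 2))))) := by
  obtain ⟨σ, h⟩ := exists_tendsto_centred_moments 1 b
  have h2 := h 2
  have h2' := ((tendsto_var_occ_div (Or.inl rfl)).add ((tendsto_var_occ_div
    (Or.inr rfl)).const_mul (b ^ 2))).add (tendsto_cov_occ_div.const_mul (2 * b))
  -- The second centred moment has two expressions for its limit, 2σ and the limiting variance over
  -- n; this identifies σ.
  have e := tendsto_nhds_unique h2 (h2'.congr fun n => by
    rw [Real.sq_sqrt (Nat.cast_nonneg n)]
    change _ = var n (linOcc 1 b n) / n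
    rw [var_linOcc]
    ring)
  have hσ : σ = 147 / 16384 * ((1 + 2 * (71 / 147) * b + b ^ 2) / 2) := by
    simp [gaussSeries] at e
    linarith
  rw [← hσ]
  exact h k

lemma coeff_gaussSeries_mul {v : ℝ} (hv : 0 < v) (s : ℝ) (k : ℕ) :
    PowerSeries.coeff k (gaussSeries (v * s)) * (√v)⁻¹ ^ k = PowerSeries.coeff k
        (gaussSeries s) := by
  simp only [gaussSeries, PowerSeries.coeff_mk]
  split_ifs with h
  · obtain ⟨m, rfl⟩ := h
    rw [← two_mul, pow_mul, inv_pow, Real.sq_sqrt hv.le, Nat.mul_div_cancel_left m two_pos]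
    field_simp
    rw [mul_pow, mul_assoc, mul_comm
        (s ^ m), ← mul_assoc, ← mul_pow, mul_one_div_cancel hv.ne', one_pow, one_mul]
  · rw [zero_mul]

/-- Convergence of the moments of linear combinations of the standardized statistics. -/
lemma tendsto_standardize_add_mul_pow (b : ℝ) (k : ℕ) : Tendsto (fun n : ℕ => mean n fun c =>
      (standardize n (occ [2, 3, 4] n) c + b * standardize n (occ [4, 3, 2] n) c) ^ k) atTop
    (𝓝 (∫ p, (p 0 + b * p 1) ^ k ∂bivariateNormal (71 / 147))) := by
  rw [integral_add_mul_pow (by norm_num), ← coeff_gaussSeries_mul (v := 147 / 16384) (by norm_num),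
    ← mul_assoc]
  have hs := (((tendsto_var_occ_div (Or.inl rfl)).sqrt).inv₀ (by positivity)).pow k
  refine ((tendsto_centred_moments b k).mul hs).congr' ?_
  filter_upwards [eventually_ge_atTop 13] with n hn
  -- The two variances agree exactly, so a common standard deviation can be factored out of the
  -- linear combination.
  have hv : var n (occ [4, 3, 2] n) = var n (occ [2, 3, 4] n) := by
    rw [(mean_var_occ (Or.inl rfl) hn).2, (mean_var_occ (Or.inr rfl) hn).2]
  have e : (fun c => (standardize n (occ [2, 3, 4] n) c + b * standardize n
      (occ [4, 3, 2] n) c) ^ k) =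
      fun c => (√(var n (occ [2, 3, 4] n)))⁻¹ ^ k *
        (linOcc 1 b n c - mean n (linOcc 1 b n)) ^ k := by
    funext c
    rw [standardize, standardize, hv, mean_linOcc, linOcc, ← mul_pow]
    congr 1
    ring
  have hn' : √(n : ℝ) ≠ 0 := Real.sqrt_ne_zero'.2 (by positivity)
  rw [e, mean_const_mul, Real.sqrt_div' _ (Nat.cast_nonneg n), inv_div, div_pow, inv_pow]
  field_simp

/-- All mixed moments of the standardized statistics converge to those of the bivariate normal
law. -/
theorem tendsto_mixed_moments (i j : ℕ) : Tendsto (fun n : ℕ => mean n fun c =>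
      standardize n (occ [2, 3, 4] n) c ^ i * standardize n (occ [4, 3, 2] n) c ^ j) atTop
    (𝓝 (∫ p, p 0 ^ i * p 1 ^ j ∂bivariateNormal (71 / 147))) := by
  set k := i + j with hk
  have expand : ∀ x y b : ℝ, (x + b * y) ^ k =
      ∑ l ∈ Finset.range (k + 1), (k.choose l * b ^ l) * (x ^ (k - l) * y ^ l) := fun x y b => by
    rw [add_comm, add_pow]
    refine Finset.sum_congr rfl fun l _ => ?_
    rw [mul_pow]
    ring
  have h : ∀ b : ℝ, Tendsto (fun n : ℕ => ∑ l ∈ Finset.range (k + 1), (k.choose l * mean n fun c =>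
      standardize n (occ [2, 3, 4] n) c ^ (k - l) * standardize n (occ [4, 3, 2] n) c ^ l) * b ^ l)
      atTop (𝓝 (∑ l ∈ Finset.range (k + 1),
        (k.choose l * ∫ p, p 0 ^ (k - l) * p 1 ^ l ∂bivariateNormal (71 / 147)) * b ^ l)) := by
    intro b
    have h := tendsto_standardize_add_mul_pow b k
    simp only [expand] at h
    rw [integral_finsetSum _ fun l _ => (integrable_coord_pow_mul_pow (k - l) l).const_mul _] at h
    simp only [integral_const_mul, mean_sum, mean_const_mul] at h
    simpa only [mul_right_comm] using h
  -- The coefficient of b^j is the mixed moment times the binomial coefficient, which is then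
  -- divided out.
  have hj := (tendsto_coeff_of_tendsto_eval h (j := j) (by omega)).const_mul
    ((k.choose j : ℝ)⁻¹)
  have hc : (k.choose j : ℝ) ≠ 0 := by
    exact_mod_cast (Nat.choose_pos (by omega)).ne'
  simpa only [inv_mul_cancel_left₀ hc, show k - j = i by omega] using hj

end Joint

end CompositionPattern

theorem theorem3 :
    -- the generating function of the avoiding compositions
    (IsUnit (CompositionPattern.avoidDenom (PowerSeries.X : PowerSeries ℤ)) ∧
      CompositionPattern.avoidSeries * CompositionPattern.avoidDenom PowerSeries.X
        = -CompositionPattern.avoidNumer PowerSeries.X) ∧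
    -- their asymptotics
    (∃ C α : ℝ, (0.548269839581 ≤ C ∧ C < 0.548269839582) ∧
      (1.976902834153 ≤ α ∧ α < 1.976902834154) ∧
      (fun n : ℕ => (CompositionPattern.avoidCount n : ℝ)) ~[atTop] fun n => C * α ^ n) ∧
    -- the trivariate generating function
    (IsUnit (CompositionPattern.denom (MvPowerSeries.X 0 : MvPowerSeries (Fin 3) ℤ)
        (MvPowerSeries.X 1) (MvPowerSeries.X 2)) ∧
      CompositionPattern.occSeries * CompositionPattern.denom (MvPowerSeries.X 0)
          (MvPowerSeries.X 1) (MvPowerSeries.X 2)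
        = CompositionPattern.numer (MvPowerSeries.X 0) (MvPowerSeries.X 1) (MvPowerSeries.X 2)) ∧
    -- expectation and variance, the same for both patterns
    (∀ b : List ℕ, b = [2, 3, 4] ∨ b = [4, 3, 2] →
      ((fun n : ℕ => CompositionPattern.mean n (CompositionPattern.occ b n))
        ~[atTop] fun n => (n : ℝ) / 128) ∧
      ((fun n : ℕ => CompositionPattern.mean n (CompositionPattern.occ b n)
          - ((n : ℝ) - 9) / 128)
        =O[atTop] fun n => (n : ℝ) / 2 ^ n) ∧
      ((fun n : ℕ => CompositionPattern.var n (CompositionPattern.occ b n)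
          - (147 / 16384 * (n : ℝ) - 1439 / 16384))
        =O[atTop] fun n => (n : ℝ) / 2 ^ n)) ∧
    -- the asymptotic correlation
    (Tendsto (fun n : ℕ => CompositionPattern.corr n (CompositionPattern.occ [2, 3, 4] n)
        (CompositionPattern.occ [4, 3, 2] n)) atTop (𝓝 (71 / 147)) ∧
      (0.482993197 ≤ (71 / 147 : ℝ) ∧ (71 / 147 : ℝ) < 0.482993198)) ∧
    -- joint asymptotic normality, up to the mixed moments of order six
    (∀ i j : ℕ, i + j ≤ 6 →
      Tendsto (fun n : ℕ => CompositionPattern.mean n fun c =>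
          CompositionPattern.standardize n (CompositionPattern.occ [2, 3, 4] n) c ^ i *
          CompositionPattern.standardize n (CompositionPattern.occ [4, 3, 2] n) c ^ j)
        atTop
        (𝓝 (∫ p, p 0 ^ i * p 1 ^ j ∂CompositionPattern.bivariateNormal (71 / 147)))) := by
  open CompositionPattern in
  exact ⟨⟨isUnit_avoidDenom, avoidSeries_mul_avoidDenom⟩, avoidCount_isEquivalent,
    ⟨isUnit_denom_mvPowerSeries, occSeries_mul_denom⟩,
    fun b hb => ⟨mean_occ_isEquivalent hb, mean_occ_isBigO hb, var_occ_isBigO hb⟩,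
    ⟨tendsto_corr_occ, by norm_num, by norm_num⟩, fun i j _ => tendsto_mixed_moments i j⟩
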